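/- **Notation.** Let $n\ge 2$ and $1\le k\le n$ be integers. Let $\mathbb R^{n+2}_k$ be $\mathbb R^{n+2}$ with $\langle v,w\rangle=-v_1w_1-\dots-v_kw_k+v_{k+1}w_{k+1}+\dots+v_{n+2}w_{n+2}$, and put $$\mathbb S^{n+1}_k=\{x\in\mathbb R^{n+2}_k:\langle x,x\rangle=1\},\qquad \mathbb H^{n-1}_{k-1}=\{y\in\mathbb R^{n+2}_k:\langle y,y\rangle=-1,\ y_{n+1}=y_{n+2}=0\}.$$ For real $h$ with $|h|>1$ let $$c_0=(2h^2-2)^{\frac{n-2}{n}}\,n\,\bigl(h(n-2)+\sqrt{4-4n+h^2n^2}\bigr)^{\frac{2-2n}{n}}\bigl(h^2n-2+h\sqrt{4-4n+h^2n^2}\bigr).$$ For real $c$ consider the equation $$(g')^2=q_1(g),\qquad q_1(t)=c-t^2+t^2(h+t^{-n})^2. \tag{1}$$ If $c<0$ and $g:\mathbb R\to(0,\infty)$ is a smooth solution of (1), put $\lambda=h+g^{-n}$, $r=g/\sqrt{-c}$, $\theta(u)=\int_0^u\frac{r\lambda}{r^2+1}\,d\tau$, $B_2(s)=(0,\dots,0,\cos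 s,\sin s)$, and $$\phi_g:\mathbb H^{n-1}_{k-1}\times\mathbb R\to\mathbb R^{n+2}_k,\qquad \phi_g(y,u)=r(u)\,y+\sqrt{r(u)^2+1}\;B_2(\theta(u)).$$ A hypersurface has constant mean curvature $h$ if, for some smooth unit normal field $\nu$, its shape operator $A$ (where $d\nu=-d\phi\circ A$) satisfies $\operatorname{tr}A=nh$ everywhere. **Theorem.** Let $n\ge2$ and let $h\in(-\infty,-1)\cup(1,\infty)$. There is a real number $c_1=c_1(n,h)$ such that for every $c<-c_0$ equation (1) has a smooth nonconstant positive solution $g$ that is defined on all of $\mathbb R$ and bounded away from zero and that, if moreover $c<0$, has the following properties for every $k$ with $1\le k\le n$: 1. $\phi_g$ is a closed (i.e. proper) smooth immersion of $\mathbb H^{n-1}_{k-1}\times\mathbb R$ into $\mathbb S^{n+1}_k$ with constant mean curvature $h$; 2. if $k=1$, then $\phi_g$ is spacelike and its induced Riemannian metric is complete; 3. if $h>1$ and $c<c_1$, then $\phi_g$ is an embedding. -/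

import Mathlib

open scoped ContDiff

noncomputable section

namespace CMC

/-- The underlying vector space `ℝ^{n+2}`; coordinates are numbered `0, …, n+1`. -/
abbrev Amb (n : ℕ) : Type := Fin (n + 2) → ℝ

/-- The metric of `ℝ_k^{n+2}`: minus signs on the first `k` coordinates, plus signs on the others. -/
def form (n k : ℕ) (v w : Amb n) : ℝ :=
  ∑ i : Fin (n + 2), (if (i : ℕ) < k then (-1 : ℝ) else 1) * v i * w i

/-- The pseudo-sphere `S_k^{n+1}` (for `k = 1`, the de Sitter space). -/
def pseudoSphere (n k : ℕ) : Set (Amb n) := {x | form n k x x = 1}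

/-- The second to last coordinate index. -/
def idx₁ (n : ℕ) : Fin (n + 2) := ⟨n, by omega⟩

/-- The last coordinate index. -/
def idx₂ (n : ℕ) : Fin (n + 2) := ⟨n + 1, by omega⟩

/-- `H_{k-1}^{n-1}`, realised in `ℝ_k^{n+2}` as the set of `y` with `⟨y, y⟩ = -1` whose last two
coordinates vanish. -/
def pseudoHyp (n k : ℕ) : Set (Amb n) :=
  {y | form n k y y = -1 ∧ y (idx₁ n) = 0 ∧ y (idx₂ n) = 0}

/-- The manifold `H_{k-1}^{n-1} × ℝ`, a regular level set in `ℝ^{n+2} × ℝ`. -/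
def dom (n k : ℕ) : Set (Amb n × ℝ) := pseudoHyp n k ×ˢ Set.univ

/-- The tangent space of `H_{k-1}^{n-1} × ℝ` at `p = (y, u)`: the pairs `(v, s)` for which the last
two coordinates of `v` vanish and `⟨v, y⟩ = 0`. -/
def tangent (n k : ℕ) (p : Amb n × ℝ) : Submodule ℝ (Amb n × ℝ) where
  carrier := {X | form n k X.1 p.1 = 0 ∧ X.1 (idx₁ n) = 0 ∧ X.1 (idx₂ n) = 0}
  add_mem' := by
    rintro X Y ⟨h1, h2, h3⟩ ⟨h4, h5, h6⟩
    refine ⟨?_, by simp [h2, h5], by simp [h3, h6]⟩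
    have : form n k (X + Y).1 p.1 = form n k X.1 p.1 + form n k Y.1 p.1 := by
      simp only [form, ← Finset.sum_add_distrib, Prod.fst_add, Pi.add_apply]
      exact Finset.sum_congr rfl fun i _ => by ring
    rw [this, h1, h4, add_zero]
  zero_mem' := by simp [form]
  smul_mem' := by
    rintro a X ⟨h1, h2, h3⟩
    refine ⟨?_, by simp [h2], by simp [h3]⟩
    have : form n k (a • X).1 p.1 = a * form n k X.1 p.1 := by
      simp only [form, Finset.mul_sum, Prod.smul_fst, Pi.smul_apply, smul_eq_mul]
      exact Finset.sum_congr rfl fun i _ => by ring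
    rw [this, h1, mul_zero]

/-! Maps from `H_{k-1}^{n-1} × ℝ` are given as smooth maps `φ` of the surrounding space
`ℝ^{n+2} × ℝ`. Only values at points of the manifold, and derivatives in tangent directions, are
used below, and these do not depend on the extension. -/

/-- `φ` restricts to a smooth immersion of `H_{k-1}^{n-1} × ℝ` into `S_k^{n+1}`. -/
def IsImmersion (n k : ℕ) (φ : Amb n × ℝ → Amb n) : Prop :=
  ContDiff ℝ ∞ φ ∧
  ∀ p ∈ dom n k, φ p ∈ pseudoSphere n k ∧
    ∀ X ∈ tangent n k p, fderiv ℝ φ p X = 0 → X = 0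

/-- Closed immersion: an immersion of `H_{k-1}^{n-1} × ℝ` that is a proper map; in particular it is
a closed map and its image is closed. -/
def IsClosedImmersion (n k : ℕ) (φ : Amb n × ℝ → Amb n) : Prop :=
  IsImmersion n k φ ∧ IsProperMap ((dom n k).domRestrict φ)

/-- Embedding: an immersion of `H_{k-1}^{n-1} × ℝ` that is a homeomorphism onto its image. -/
def IsEmbedded (n k : ℕ) (φ : Amb n × ℝ → Amb n) : Prop :=
  IsImmersion n k φ ∧ Topology.IsEmbedding ((dom n k).domRestrict φ)

/-- The hypersurface `φ` of `S_k^{n+1}` has constant mean curvature `h`: there is a smooth unit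
normal field `ν` along `φ`, tangent to `S_k^{n+1}`, whose shape operator `A`, given by
`dν(X) = -dφ(A X)`, satisfies `trace A = n h` at every point. -/
def HasConstantMeanCurvature (n k : ℕ) (φ : Amb n × ℝ → Amb n) (h : ℝ) : Prop :=
  ∃ ν : Amb n × ℝ → Amb n, ContDiff ℝ ∞ ν ∧
    ∀ p ∈ dom n k,
      |form n k (ν p) (ν p)| = 1 ∧
      form n k (ν p) (φ p) = 0 ∧
      (∀ X ∈ tangent n k p, form n k (ν p) (fderiv ℝ φ p X) = 0) ∧
      ∃ A : tangent n k p →ₗ[ℝ] tangent n k p,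
        (∀ X : tangent n k p, fderiv ℝ ν p (X : Amb n × ℝ) = -fderiv ℝ φ p (A X : Amb n × ℝ)) ∧
        LinearMap.trace ℝ (tangent n k p) A = n * h

/-- The metric induced by `φ`. -/
def inducedMetric (n k : ℕ) (φ : Amb n × ℝ → Amb n) (p X Y : Amb n × ℝ) : ℝ :=
  form n k (fderiv ℝ φ p X) (fderiv ℝ φ p Y)

/-- The induced metric is Riemannian. -/
def IsSpacelike (n k : ℕ) (φ : Amb n × ℝ → Amb n) : Prop :=
  ∀ p ∈ dom n k, ∀ X ∈ tangent n k p, X ≠ 0 → 0 < inducedMetric n k φ p X X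

/-- Length of a `C¹` curve `γ : [0, 1] → H_{k-1}^{n-1} × ℝ` in the metric induced by `φ`. -/
def curveLength (n k : ℕ) (φ : Amb n × ℝ → Amb n) (γ : ℝ → Amb n × ℝ) : ENNReal :=
  ∫⁻ t in Set.Icc (0 : ℝ) 1, ENNReal.ofReal (Real.sqrt (inducedMetric n k φ (γ t)
    (derivWithin γ (Set.Icc 0 1) t) (derivWithin γ (Set.Icc 0 1) t)))

/-- Distance of the induced metric: the infimum of the lengths of the `C¹` curves in
`H_{k-1}^{n-1} × ℝ` from `p` to `q` (it is `∞` if there is no such curve). -/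
def inducedDist (n k : ℕ) (φ : Amb n × ℝ → Amb n) (p q : Amb n × ℝ) : ENNReal :=
  ⨅ (γ : ℝ → Amb n × ℝ) (_ : ContDiffOn ℝ 1 γ (Set.Icc 0 1) ∧
      (∀ t ∈ Set.Icc (0 : ℝ) 1, γ t ∈ dom n k) ∧ γ 0 = p ∧ γ 1 = q), curveLength n k φ γ

/-- Completeness of the induced (Riemannian) metric: every Cauchy sequence for the induced distance
converges in `H_{k-1}^{n-1} × ℝ`. -/
def IsCompleteMetric (n k : ℕ) (φ : Amb n × ℝ → Amb n) : Prop :=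
  ∀ x : ℕ → Amb n × ℝ, (∀ j, x j ∈ dom n k) →
    (∀ ε : ENNReal, 0 < ε → ∃ N, ∀ i ≥ N, ∀ j ≥ N, inducedDist n k φ (x i) (x j) < ε) →
    ∃ p ∈ dom n k, Filter.Tendsto (fun j => inducedDist n k φ (x j) p) Filter.atTop (nhds 0)

/-- `q₁(t) = c - t² + t² (h + t^{-n})²`. -/
def q₁ (n : ℕ) (h c t : ℝ) : ℝ := c - t ^ 2 + t ^ 2 * (h + (t ^ n)⁻¹) ^ 2

/-- `g` is a smooth nonconstant solution of `(g')² = q₁(g)` on all of `ℝ`, bounded away from zero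
by a positive constant. -/
def IsGlobalSolution (n : ℕ) (h c : ℝ) (g : ℝ → ℝ) : Prop :=
  ContDiff ℝ ∞ g ∧ (∀ t, (deriv g t) ^ 2 = q₁ n h c (g t)) ∧
    (∃ s t, g s ≠ g t) ∧ ∃ m > 0, ∀ t, m ≤ g t

/-- The constant `c₀`. -/
def c₀ (n : ℕ) (h : ℝ) : ℝ :=
  (2 * h ^ 2 - 2) ^ (((n : ℝ) - 2) / n) * n *
    (h * ((n : ℝ) - 2) + Real.sqrt (4 - 4 * n + h ^ 2 * n ^ 2)) ^ ((2 - 2 * (n : ℝ)) / n) *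
    (h ^ 2 * n - 2 + h * Real.sqrt (4 - 4 * n + h ^ 2 * n ^ 2))

/-- `λ = h + g^{-n}`. -/
def lam (n : ℕ) (h : ℝ) (g : ℝ → ℝ) (t : ℝ) : ℝ := h + (g t ^ n)⁻¹

/-- `r = g / √(-c)`. -/
def rad (c : ℝ) (g : ℝ → ℝ) (t : ℝ) : ℝ := g t / Real.sqrt (-c)

/-- `θ(t) = ∫₀ᵗ r λ / (r² + 1)`. -/
def theta (n : ℕ) (h c : ℝ) (g : ℝ → ℝ) (t : ℝ) : ℝ :=
  ∫ τ in (0 : ℝ)..t, rad c g τ * lam n h g τ / (rad c g τ ^ 2 + 1)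

/-- `B₂(t) = (0, …, 0, cos t, sin t)`. -/
def B₂ (n : ℕ) (t : ℝ) : Amb n :=
  Pi.single (idx₁ n) (Real.cos t) + Pi.single (idx₂ n) (Real.sin t)

/-- `φ(y, u) = r(u) y + √(r(u)² + 1) B₂(θ(u))`. -/
def phi (n : ℕ) (h c : ℝ) (g : ℝ → ℝ) (p : Amb n × ℝ) : Amb n :=
  rad c g p.2 • p.1 + Real.sqrt (rad c g p.2 ^ 2 + 1) • B₂ n (theta n h c g p.2)

end CMC

end

/-! Write w = t^{-n}. Then q₁(t) = c + t²((h+w)² - 1) and q₁'(t) = 2t·rate(w), where `rate` is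
quadratic in w, has the value h² - 1 > 0 at w = 0 and has a single positive root w₀. The
corresponding t is the last critical point of q₁, and the value of q₁ there is c + c₀
(`exists_critical`). So for c < -c₀ the function q₁ is negative there, tends to +∞, and vanishes at
some later t₀. Beyond t₀ the rate lies between positive constants, so the solution that bounces at
t₀ exists for all time. Substituting g = t₀ cosh X turns the equation, which degenerates at t₀, into
a regular one for X (`exists_globalSolution`).

When c < 0, the functions r, m = rλ, μ = nh - (n-1)λ and θ satisfy the first-order system
`IsProfile`, and the geometry follows from that system alone. The induced metric is r²⟨,⟩ + du². The
principal curvatures are λ, repeated n-1 times, and μ, so the trace is nh. Properness holds because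
r → ∞ at both ends and the last two coordinates have Euclidean length √(r²+1). For k = 1,
completeness follows because u and r₀ arsinh(yᵢ) are 1-Lipschitz for the induced distance.

For embeddedness, the last two coordinates determine r and θ modulo 2π, so it is enough that θ
increases by less than 2π in total. When g stays large, λ is close to h > 1 and θ' is at most the
derivative of (3/2) arctan(r'/h), whose total variation is at most 3π/2 (`theta_lt_theta`). Taking c
very negative moves t₀, and hence g, as far out as needed. -/

noncomputable section

namespace CMC

open Filter Topology Set MeasureTheory

/-! ### Global solutions of (g')² = q₁(g) -/

/-- An autonomous scalar equation with a smooth right-hand side bounded between positive constants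
has a smooth global solution. -/
theorem exists_flow {s : ℝ → ℝ} (hs : ContDiff ℝ ∞ s) {a b : ℝ} (ha : 0 < a)
    (has : ∀ x, a ≤ s x) (hsb : ∀ x, s x ≤ b) :
    ∃ X : ℝ → ℝ, ContDiff ℝ ∞ X ∧ (∀ u, HasDerivAt X (s (X u)) u) ∧ ∀ u, a * |u| ≤ |X u| := by
  have hpos : ∀ x, 0 < s x := fun x => ha.trans_le (has x)
  have hb : 0 < b := (hpos 0).trans_le (hsb 0)
  have hcont : Continuous fun x => (s x)⁻¹ := hs.continuous.inv₀ fun x => (hpos x).ne'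
  -- Separation of variables: U is the time needed to reach x, and the flow is its inverse. The
  -- bounds on s make U grow at least like x/b and at most like x/a.
  set U : ℝ → ℝ := fun x => ∫ t in (0 : ℝ)..x, (s t)⁻¹ with hU
  have hU' : ∀ x, HasDerivAt U (s x)⁻¹ x := fun x =>
    intervalIntegral.integral_hasDerivAt_right (hcont.intervalIntegrable _ _)
      hcont.stronglyMeasurable.stronglyMeasurableAtFilter hcont.continuousAt
  have hU0 : U 0 = 0 := by simp [hU]
  have hmono : StrictMono U := strictMono_of_deriv_pos fun x => by
    rw [(hU' x).deriv]; exact inv_pos.2 (hpos x)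
  have hUc : Continuous U := continuous_iff_continuousAt.2 fun x => (hU' x).continuousAt
  have hlow : Monotone fun x => U x - x / b := by
    refine monotone_of_deriv_nonneg
      (fun x => ((hU' x).sub ((hasDerivAt_id x).div_const b)).differentiableAt) fun x => ?_
    have h1 := ((hU' x).sub ((hasDerivAt_id x).div_const b)).deriv
    have h2 : 1 / b ≤ (s x)⁻¹ := by
      rw [one_div]; exact inv_anti₀ (hpos x) (hsb x)
    change 0 ≤ deriv (U - fun x => id x / b) x
    rw [h1]; linarith
  have hup : Monotone fun x => x / a - U x := by
    refine monotone_of_deriv_nonneg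
      (fun x => (((hasDerivAt_id x).div_const a).sub (hU' x)).differentiableAt) fun x => ?_
    have h1 := (((hasDerivAt_id x).div_const a).sub (hU' x)).deriv
    have h2 : (s x)⁻¹ ≤ 1 / a := by
      rw [one_div]; exact inv_anti₀ ha (has x)
    change 0 ≤ deriv ((fun x => id x / a) - U) x
    rw [h1]; linarith
  have htop : Tendsto U atTop atTop := by
    refine tendsto_atTop_mono' _ ?_ (tendsto_id.atTop_div_const hb)
    filter_upwards [eventually_ge_atTop 0] with x hx
    have := hlow hx
    simp only [hU0, zero_div] at this
    simp only [id]; linarith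
  have hbot : Tendsto U atBot atBot := by
    refine tendsto_atBot_mono' _ ?_ (tendsto_id.atBot_div_const hb)
    filter_upwards [eventually_le_atBot 0] with x hx
    have := hlow hx
    simp only [hU0, zero_div] at this
    simp only [id]; linarith
  let e := hmono.orderIsoOfSurjective U (hUc.surjective htop hbot)
  have hUe : ∀ u, U (e.symm u) = u := fun u => e.apply_symm_apply u
  have hX : ∀ u, HasDerivAt e.symm (s (e.symm u)) u := fun u => by
    have := HasDerivAt.of_local_left_inverse (f := U) (g := e.symm) (a := u)
      e.symm.continuous.continuousAt (hU' _) (inv_ne_zero (hpos _).ne') (Eventually.of_forall hUe)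
    simpa using this
  refine ⟨e.symm, ?_, hX, fun u => ?_⟩
  -- Bootstrap: X' = s ∘ X is as smooth as X, so X gains one derivative at each step.
  · refine contDiff_infty.2 fun m => ?_
    induction m with
    | zero => exact contDiff_zero.2 e.symm.continuous
    | succ m ih =>
      have hd : deriv e.symm = fun u => s (e.symm u) := funext fun u => (hX u).deriv
      rw [Nat.cast_succ, contDiff_succ_iff_deriv]
      refine ⟨fun u => (hX u).differentiableAt, by simp, ?_⟩
      rw [hd]
      exact (contDiff_infty.1 hs m).comp ih
  · have key : ∀ x, a * |U x| ≤ |x| := fun x => by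
      rcases le_total 0 x with hx | hx
      · have h1 := hup hx
        have h2 := hmono.monotone hx
        simp only [hU0, zero_div] at h1 h2
        rw [abs_of_nonneg h2, abs_of_nonneg hx]
        have : U x ≤ x / a := by linarith
        rw [le_div_iff₀ ha] at this; linarith
      · have h1 := hup hx
        have h2 := hmono.monotone hx
        simp only [hU0, zero_div] at h1 h2
        rw [abs_of_nonpos h2, abs_of_nonpos hx]
        have : x / a ≤ U x := by linarith
        rw [div_le_iff₀ ha] at this; linarith
    simpa [hUe] using key (e.symm u)

/-- The quotient `q₁'(t) / (2 t)` as a function of `w = t^{-n}`. -/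
def rate (n : ℕ) (h w : ℝ) : ℝ := (h + w) ^ 2 - 1 - n * (h + w) * w

theorem continuous_rate (n : ℕ) (h : ℝ) : Continuous (rate n h) := by
  unfold rate; fun_prop

theorem hasDerivAt_inv_pow (n : ℕ) {t : ℝ} (ht : t ≠ 0) :
    HasDerivAt (fun t : ℝ => (t ^ n)⁻¹) (-(n * (t ^ n)⁻¹ / t)) t := by
  refine ((hasDerivAt_pow n t).inv (pow_ne_zero n ht)).congr_deriv ?_
  rcases n with _ | n
  · simp
  · rw [Nat.add_sub_cancel]; field_simp; ring

theorem hasDerivAt_q₁ (n : ℕ) (h c : ℝ) {t : ℝ} (ht : t ≠ 0) :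
    HasDerivAt (q₁ n h c) (2 * t * rate n h (t ^ n)⁻¹) t := by
  have hw := hasDerivAt_inv_pow n ht
  have h1 := ((hasDerivAt_pow 2 t).const_sub c).add
    ((hasDerivAt_pow 2 t).mul ((hw.const_add h).pow 2))
  refine h1.congr_deriv ?_
  simp only [rate, Pi.pow_apply]
  push_cast
  field_simp
  ring

/-- Multiplying q₁ by t^{2n-2} gives a polynomial, so the root t₀ splits off algebraically. The
quotient is then smooth at t₀ too, with no Taylor argument. -/
theorem exists_factor_q₁ {n : ℕ} (hn : 2 ≤ n) {h c t₀ : ℝ} (h0 : 0 < t₀) (hq : q₁ n h c t₀ = 0) :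
    ∃ R : Polynomial ℝ, ∀ t > 0, q₁ n h c t = (t - t₀) * R.eval t / t ^ (2 * n - 2) := by
  obtain ⟨m, rfl⟩ : ∃ m, n = m + 2 := ⟨n - 2, by omega⟩
  let Q : Polynomial ℝ := Polynomial.C c * Polynomial.X ^ (2 * m + 2)
    + Polynomial.C (h ^ 2 - 1) * Polynomial.X ^ (2 * m + 4)
    + Polynomial.C (2 * h) * Polynomial.X ^ (m + 2) + 1
  have hQ : ∀ t > 0, q₁ (m + 2) h c t = Q.eval t / t ^ (2 * m + 2) := by
    intro t ht
    simp only [q₁, Q, Polynomial.eval_add, Polynomial.eval_mul, Polynomial.eval_C,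
      Polynomial.eval_pow, Polynomial.eval_X, Polynomial.eval_one]
    field_simp
    ring
  have hroot : Q.IsRoot t₀ := by
    have := hQ t₀ h0
    rw [hq, eq_comm, div_eq_zero_iff] at this
    exact this.resolve_right (pow_pos h0 _).ne'
  obtain ⟨R, hR⟩ := Polynomial.dvd_iff_isRoot.2 hroot
  refine ⟨R, fun t ht => ?_⟩
  rw [hQ t ht, hR]
  simp [show 2 * (m + 2) - 2 = 2 * m + 2 by omega]

/-- Starting from a root of `q₁` beyond which `q₁'(t) / t` is bounded between positive constants,
the equation has a global solution which is proper and solves the second-order equation. -/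
theorem exists_globalSolution {n : ℕ} (hn : 2 ≤ n) {h c t₀ κ M : ℝ} (h0 : 0 < t₀)
    (hq : q₁ n h c t₀ = 0) (hκ : 0 < κ) (hlow : ∀ t ≥ t₀, κ ≤ rate n h (t ^ n)⁻¹)
    (hup : ∀ t ≥ t₀, rate n h (t ^ n)⁻¹ ≤ M) :
    ∃ g : ℝ → ℝ, IsGlobalSolution n h c g ∧ (∀ u, t₀ ≤ g u) ∧
      (∀ u, HasDerivAt (deriv g) (g u * rate n h (g u ^ n)⁻¹) u) ∧
      Tendsto g (cocompact ℝ) atTop := by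
  obtain ⟨R, hR⟩ := exists_factor_q₁ hn h0 hq
  -- With q₁ = (t² - t₀²) p and g = t₀ cosh X, the equation reads t₀² sinh² X · (X')² = t₀² sinh² X
  -- · p(g). It therefore suffices to solve X' = √p(t₀ cosh X).
  set p : ℝ → ℝ := fun t => R.eval t / (t ^ (2 * n - 2) * (t + t₀)) with hp
  have hden : ∀ t, t₀ ≤ t → t ^ (2 * n - 2) * (t + t₀) ≠ 0 := fun t ht => by
    have := h0.trans_le ht
    positivity
  have hqp : ∀ t, t₀ ≤ t → q₁ n h c t = (t ^ 2 - t₀ ^ 2) * p t := fun t ht => by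
    have h1 : 0 < t := h0.trans_le ht
    have h2 : t + t₀ ≠ 0 := by positivity
    rw [hR t h1, hp]; field_simp; ring
  have hmono : ∀ K : ℝ, ∀ t, t₀ ≤ t → HasDerivAt (fun t => q₁ n h c t - K * t ^ 2)
      (2 * t * (rate n h (t ^ n)⁻¹ - K)) t := fun K t ht => by
    refine ((hasDerivAt_q₁ n h c (h0.trans_le ht).ne').sub
      ((hasDerivAt_pow 2 t).const_mul K)).congr_deriv ?_
    push_cast; ring
  have hqlow : ∀ t, t₀ ≤ t → κ * (t ^ 2 - t₀ ^ 2) ≤ q₁ n h c t := fun t ht => by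
    have := monotoneOn_of_deriv_nonneg (convex_Ici t₀)
      (fun x hx => (hmono κ x hx).continuousAt.continuousWithinAt)
      (fun x hx => (hmono κ x (interior_subset hx)).differentiableAt.differentiableWithinAt)
      (fun x hx => by
        have hx' : t₀ ≤ x := interior_subset hx
        have := hlow x hx'
        have hx0 : 0 < x := h0.trans_le hx'
        rw [(hmono κ x hx').deriv]
        exact mul_nonneg (by positivity) (by linarith)) (mem_Ici.2 le_rfl) (mem_Ici.2 ht) ht
    simp only [hq] at this; linarith
  have hqup : ∀ t, t₀ ≤ t → q₁ n h c t ≤ M * (t ^ 2 - t₀ ^ 2) := fun t ht => by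
    have := antitoneOn_of_deriv_nonpos (convex_Ici t₀)
      (fun x hx => (hmono M x hx).continuousAt.continuousWithinAt)
      (fun x hx => (hmono M x (interior_subset hx)).differentiableAt.differentiableWithinAt)
      (fun x hx => by
        have hx' : t₀ ≤ x := interior_subset hx
        have := hup x hx'
        have hx0 : 0 < x := h0.trans_le hx'
        rw [(hmono M x hx').deriv]
        exact mul_nonpos_of_nonneg_of_nonpos (by positivity) (by linarith))
      (mem_Ici.2 le_rfl) (mem_Ici.2 ht) ht
    simp only [hq] at this; linarith
  have hcosh : ∀ x, t₀ ≤ t₀ * Real.cosh x := fun x =>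
    le_mul_of_one_le_right h0.le (Real.one_le_cosh x)
  set P : ℝ → ℝ := fun x => p (t₀ * Real.cosh x) with hP
  have hPs : ContDiff ℝ ∞ P := by
    have h1 : ContDiff ℝ ∞ fun x => t₀ * Real.cosh x := contDiff_const.mul Real.contDiff_cosh
    exact ((R.contDiff_aeval ∞).comp h1).div ((h1.pow _).mul (h1.add contDiff_const))
      fun x => hden _ (hcosh x)
  have hPmem : ∀ x, P x ∈ Icc κ M := by
    -- At x = 0 the bounds on q₁ degenerate to 0 ≤ 0, so there the bounds on p come from continuity.
    have hdense : Dense ({0}ᶜ : Set ℝ) := dense_compl_singleton 0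
    have hsub : ({0}ᶜ : Set ℝ) ⊆ P ⁻¹' Icc κ M := fun x hx => by
      have h1 : t₀ < t₀ * Real.cosh x := lt_mul_of_one_lt_right h0 (Real.one_lt_cosh.2 hx)
      have h2 : 0 < (t₀ * Real.cosh x) ^ 2 - t₀ ^ 2 := by nlinarith
      have h3 := hqlow _ h1.le
      have h4 := hqup _ h1.le
      rw [hqp _ h1.le, mul_comm] at h3 h4
      exact ⟨le_of_mul_le_mul_left (by linarith) h2, le_of_mul_le_mul_left (by linarith) h2⟩
    intro x
    exact closure_minimal hsub (isClosed_Icc.preimage hPs.continuous) (hdense x)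
  have hPpos : ∀ x, 0 < P x := fun x => hκ.trans_le (hPmem x).1
  obtain ⟨X, hXs, hX', hXab⟩ := exists_flow (s := fun x => √(P x)) (a := √κ) (b := √M)
    (hPs.sqrt fun x => (hPpos x).ne') (Real.sqrt_pos.2 hκ)
    (fun x => Real.sqrt_le_sqrt (hPmem x).1) (fun x => Real.sqrt_le_sqrt (hPmem x).2)
  have hXmono : StrictMono X := strictMono_of_deriv_pos fun u => by
    rw [(hX' u).deriv]; exact Real.sqrt_pos.2 (hPpos _)
  set g : ℝ → ℝ := fun u => t₀ * Real.cosh (X u) with hg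
  have hgs : ContDiff ℝ ∞ g := contDiff_const.mul (Real.contDiff_cosh.comp hXs)
  have hg' : ∀ u, deriv g u = t₀ * (Real.sinh (X u) * √(P (X u))) := fun u =>
    ((hX' u).cosh.const_mul t₀).deriv
  have hg0 : ∀ u, t₀ ≤ g u := fun u => hcosh _
  have hode : ∀ u, deriv g u ^ 2 = q₁ n h c (g u) := fun u => by
    rw [hg', hqp _ (hg0 u), mul_pow, mul_pow, Real.sq_sqrt (hPpos _).le, Real.sinh_sq]
    simp only [hg, hP]; ring
  have htend : Tendsto g (cocompact ℝ) atTop := by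
    have h1 : Tendsto (fun u : ℝ => t₀ * (√κ * |u|)) (cocompact ℝ) atTop :=
      ((tendsto_norm_cocompact_atTop (E := ℝ)).const_mul_atTop (Real.sqrt_pos.2 hκ)).const_mul_atTop
        h0
    refine tendsto_atTop_mono (fun u => ?_) h1
    have h2 : |X u| ≤ Real.cosh (X u) := by
      rw [← Real.cosh_abs]
      have h3 := Real.self_le_sinh_iff.2 (abs_nonneg (X u))
      exact h3.trans (Real.sinh_lt_cosh _).le
    exact mul_le_mul_of_nonneg_left ((hXab u).trans h2) h0.le
  have hgd : ContDiff ℝ ∞ (deriv g) := (contDiff_infty_iff_deriv.1 hgs).2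
  have hgdiff : ∀ u, HasDerivAt g (deriv g u) u := fun u =>
    (hgs.differentiable (by simp) u).hasDerivAt
  have hgdd : ∀ u, HasDerivAt (deriv g) (deriv (deriv g) u) u := fun u =>
    (hgd.differentiable (by simp) u).hasDerivAt
  have hgne : ∀ u, g u ≠ 0 := fun u => (h0.trans_le (hg0 u)).ne'
  have hsecond : deriv (deriv g) = fun u => g u * rate n h (g u ^ n)⁻¹ := by
    -- Differentiating (g')² = q₁(g) gives the second-order equation only where g' ≠ 0. As X is
    -- strictly increasing, this fails at one point at most, and continuity covers that point.
    have hdense : Dense {u | X u ≠ 0} := by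
      by_cases hz : ∃ u, X u = 0
      · obtain ⟨u₀, hu₀⟩ := hz
        have hsub : ({u₀}ᶜ : Set ℝ) ⊆ {u | X u ≠ 0} := fun u hu hXu =>
          hu (hXmono.injective (hXu.trans hu₀.symm))
        exact (dense_compl_singleton u₀).mono hsub
      · push Not at hz
        simp [hz]
    refine Continuous.ext_on hdense (contDiff_infty_iff_deriv.1 hgd).2.continuous ?_ fun u hu => ?_
    · exact hgs.continuous.mul ((continuous_rate n h).comp
        ((hgs.continuous.pow n).inv₀ fun u => pow_ne_zero n (hgne u)))
    · have h1 := (hgdd u).pow 2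
      have h2 := (hasDerivAt_q₁ n h c (hgne u)).comp u (hgdiff u)
      have h3 : (deriv g) ^ 2 = q₁ n h c ∘ g := funext hode
      rw [h3] at h1
      have h4 := h1.unique h2
      have h5 : deriv g u ≠ 0 := by
        rw [hg']
        exact mul_ne_zero h0.ne' (mul_ne_zero (Real.sinh_ne_zero.2 hu)
          (Real.sqrt_pos.2 (hPpos _)).ne')
      apply mul_left_cancel₀ (mul_ne_zero two_ne_zero h5)
      simp only [Nat.cast_ofNat, Nat.add_one_sub_one, pow_one] at h4
      linarith
  refine ⟨g, ⟨hgs, hode, ?_, t₀, h0, hg0⟩, hg0, fun u => ?_, htend⟩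
  · obtain ⟨u, hu⟩ := (htend.eventually_gt_atTop (g 0)).exists
    exact ⟨u, 0, hu.ne'⟩
  · have := hgdd u
    rwa [hsecond] at this

/-- The largest critical point of `q₁`, at which `q₁` takes the value `c + c₀`. -/
theorem exists_critical {n : ℕ} (hn : 2 ≤ n) {h : ℝ} (hh : h < -1 ∨ 1 < h) :
    ∃ t > 0, rate n h (t ^ n)⁻¹ = 0 ∧ ∀ c, q₁ n h c t = c + c₀ n h := by
  have hn' : (2 : ℝ) ≤ n := by exact_mod_cast hn
  have hh2 : 1 < h ^ 2 := by rcases hh with hh | hh <;> nlinarith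
  set D : ℝ := 4 - 4 * n + h ^ 2 * n ^ 2 with hD
  set S := √D with hS
  have hD0 : (h * ((n : ℝ) - 2)) ^ 2 < D := by
    have : 0 < (h ^ 2 - 1) * (n - 1) := mul_pos (by linarith) (by linarith)
    rw [hD]; nlinarith
  have hS2 : S ^ 2 = D := Real.sq_sqrt ((sq_nonneg _).trans hD0.le)
  have hSd : |h * ((n : ℝ) - 2)| < S := by rwa [hS, Real.lt_sqrt (abs_nonneg _), sq_abs]
  set d := h * ((n : ℝ) - 2) + S with hd
  have hd0 : 0 < d := by have := (abs_lt.1 hSd).1; linarith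
  set a := 2 * h ^ 2 - 2 with ha
  have ha0 : 0 < a := by rw [ha]; linarith
  -- The positive root of (n-1)w² + (n-2)hw - (h²-1) = 0, with the numerator rationalised.
  set w := a / d with hw
  have hw0 : 0 < w := div_pos ha0 hd0
  have hwd : w * d = a := div_mul_cancel₀ _ hd0.ne'
  have hnn : (n : ℝ) ≠ 0 := by positivity
  refine ⟨w ^ (-1 / (n : ℝ)), Real.rpow_pos_of_pos hw0 _, ?_, fun c => ?_⟩ <;>
  have hpow : ((w ^ (-1 / (n : ℝ))) ^ n)⁻¹ = w := by
    rw [← Real.rpow_natCast, ← Real.rpow_mul hw0.le, div_mul_cancel₀ _ hnn, Real.rpow_neg_one,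
      inv_inv]
  · rw [hpow, rate]
    have : d ^ 2 * ((h + w) ^ 2 - 1 - n * (h + w) * w) = 0 := by
      have e1 : d ^ 2 * ((h + w) ^ 2 - 1 - n * (h + w) * w) =
        (h * d + w * d) ^ 2 - d ^ 2 - n * (h * d + w * d) * (w * d) := by ring
      rw [e1, hwd, hd, ha]
      linear_combination (h ^ 2 - 1) * hS2
    exact (mul_eq_zero.1 this).resolve_left (by positivity)
  · rw [q₁, hpow]
    have e1 : c₀ n h = w ^ (-2 / (n : ℝ)) * (n * a * (h ^ 2 * n - 2 + h * S) / d ^ 2) := by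
      rw [c₀, ← ha, ← hD, ← hS, ← hd]
      have e2 : ((n : ℝ) - 2) / n = -2 / n + 1 := by field_simp; ring
      have e3 : (2 - 2 * (n : ℝ)) / n = -(-2 / n) - 2 := by field_simp
      rw [e2, e3, Real.rpow_add ha0, Real.rpow_one, Real.rpow_sub hd0, Real.rpow_neg hd0.le, hw,
        Real.div_rpow ha0.le hd0.le, Real.rpow_two]
      field_simp
    have e4 : (w ^ (-1 / (n : ℝ))) ^ 2 = w ^ (-2 / (n : ℝ)) := by
      rw [← Real.rpow_natCast, ← Real.rpow_mul hw0.le]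
      congr 1; push_cast; ring
    have e5 : (h + w) ^ 2 - 1 = n * a * (h ^ 2 * n - 2 + h * S) / d ^ 2 := by
      rw [eq_div_iff (by positivity)]
      have : ((h + w) ^ 2 - 1) * d ^ 2 = (h * d + w * d) ^ 2 - d ^ 2 := by ring
      rw [this, hwd, hd, ha]
      linear_combination (h ^ 2 - 1) * hS2
    rw [e1, e4, ← e5]; ring

/-- The combination w₀·rate(w) - w·rate(w₀) cancels the linear term of `rate`, whose sign depends on
that of h. What remains is visibly positive. -/
theorem rate_pos {n : ℕ} (hn : 2 ≤ n) {h w₀ w : ℝ} (hh : 1 < h ^ 2) (hr : rate n h w₀ = 0)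
    (hw : 0 ≤ w) (hw₀ : w < w₀) : 0 < rate n h w := by
  have hn' : (2 : ℝ) ≤ n := by exact_mod_cast hn
  have e : w₀ * rate n h w = (w₀ - w) * (h ^ 2 - 1) + w * rate n h w₀
      + (n - 1) * w * (w₀ - w) * w₀ := by
    simp only [rate]; ring
  rw [hr] at e
  have h1 : 0 < w₀ := hw.trans_lt hw₀
  have h2 : 0 < (w₀ - w) * (h ^ 2 - 1) := mul_pos (by linarith) (by linarith)
  have h3 : 0 ≤ (n - 1) * w * (w₀ - w) * w₀ :=
    mul_nonneg (mul_nonneg (mul_nonneg (by linarith) hw) (by linarith)) h1.le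
  exact pos_of_mul_pos_right (a := w₀) (by rw [e]; linarith) h1.le

theorem tendsto_inv_pow {n : ℕ} (hn : 2 ≤ n) :
    Tendsto (fun t : ℝ => (t ^ n)⁻¹) atTop (𝓝 0) :=
  tendsto_inv_atTop_zero.comp (tendsto_pow_atTop (by omega))

theorem tendsto_q₁ {n : ℕ} (hn : 2 ≤ n) {h : ℝ} (hh : 1 < h ^ 2) (c : ℝ) :
    Tendsto (q₁ n h c) atTop atTop := by
  have h1 : Tendsto (fun t : ℝ => (h + (t ^ n)⁻¹) ^ 2 - 1) atTop (𝓝 (h ^ 2 - 1)) := by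
    simpa using (((tendsto_inv_pow hn).const_add h).pow 2).sub_const 1
  have h2 := ((tendsto_pow_atTop (α := ℝ) (two_ne_zero)).atTop_mul_pos (by linarith) h1)
  refine (tendsto_atTop_add_const_left _ c h2).congr fun t => ?_
  rw [q₁]; ring

/-- The point a can be any point past the critical one at which q₁ < 0, and the solution stays above
it. Embeddedness needs this freedom, since there a must be large. -/
theorem exists_globalSolution_of_neg {n : ℕ} (hn : 2 ≤ n) {h c t a : ℝ} (hh : 1 < h ^ 2)
    (ht : 0 < t) (hr : rate n h (t ^ n)⁻¹ = 0) (hta : t ≤ a) (hqa : q₁ n h c a < 0) :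
    ∃ g : ℝ → ℝ, IsGlobalSolution n h c g ∧ (∀ u, a ≤ g u) ∧
      (∀ u, HasDerivAt (deriv g) (g u * rate n h (g u ^ n)⁻¹) u) ∧
      Tendsto g (cocompact ℝ) atTop := by
  have ha : 0 < a := ht.trans_le hta
  obtain ⟨b, hab, hb⟩ := ((eventually_ge_atTop a).and
    ((tendsto_q₁ hn hh c).eventually_gt_atTop 0)).exists
  obtain ⟨t₀, ht₀, hq⟩ : (0 : ℝ) ∈ q₁ n h c '' Icc a b :=
    intermediate_value_Icc hab (fun x hx =>
      (hasDerivAt_q₁ n h c (ha.trans_le hx.1).ne').continuousAt.continuousWithinAt) ⟨hqa.le, hb.le⟩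
  have hat : a < t₀ := lt_of_le_of_ne ht₀.1 fun e => by rw [e, hq] at hqa; exact lt_irrefl _ hqa
  have h0 : 0 < t₀ := ha.trans hat
  have hw : (t₀ ^ n)⁻¹ < (t ^ n)⁻¹ :=
    inv_strictAnti₀ (pow_pos ht n) (pow_lt_pow_left₀ (hta.trans_lt hat) ht.le (by omega))
  have hne : (Icc 0 (t₀ ^ n)⁻¹).Nonempty := ⟨0, le_rfl, by positivity⟩
  obtain ⟨w₁, hw₁, hmin⟩ := isCompact_Icc.exists_isMinOn hne (continuous_rate n h).continuousOn
  obtain ⟨w₂, hw₂, hmax⟩ := isCompact_Icc.exists_isMaxOn hne (continuous_rate n h).continuousOn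
  have hmem : ∀ s ≥ t₀, (s ^ n)⁻¹ ∈ Icc 0 (t₀ ^ n)⁻¹ := fun s hs =>
    ⟨by have := h0.trans_le hs; positivity, inv_anti₀ (pow_pos h0 n) (pow_le_pow_left₀ h0.le hs n)⟩
  obtain ⟨g, h1, h2, h3, h4⟩ := exists_globalSolution hn h0 hq
    (rate_pos hn hh hr hw₁.1 (hw₁.2.trans_lt hw)) (fun s hs => hmin (hmem s hs))
    (fun s hs => hmax (hmem s hs))
  exact ⟨g, h1, fun u => hat.le.trans (h2 u), h3, h4⟩

/-! ### Algebra of the indefinite form, and derivatives of a(u) y + W(u) -/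

section Form

variable {n k : ℕ}

theorem form_comm (v w : Amb n) : form n k v w = form n k w v :=
  Finset.sum_congr rfl fun i _ => by ring

theorem form_add_left (v v' w : Amb n) : form n k (v + v') w = form n k v w + form n k v' w := by
  simp only [form, ← Finset.sum_add_distrib, Pi.add_apply]
  exact Finset.sum_congr rfl fun i _ => by ring

theorem form_smul_left (a : ℝ) (v w : Amb n) : form n k (a • v) w = a * form n k v w := by
  simp only [form, Finset.mul_sum, Pi.smul_apply, smul_eq_mul]
  exact Finset.sum_congr rfl fun i _ => by ring

theorem form_add_right (v w w' : Amb n) : form n k v (w + w') = form n k v w + form n k v w' := by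
  rw [form_comm, form_add_left, form_comm w, form_comm w']

theorem form_smul_right (a : ℝ) (v w : Amb n) : form n k v (a • w) = a * form n k v w := by
  rw [form_comm, form_smul_left, form_comm w]

theorem form_single_right (v : Amb n) (i : Fin (n + 2)) (a : ℝ) :
    form n k v (Pi.single i a) = (if (i : ℕ) < k then (-1 : ℝ) else 1) * v i * a := by
  rw [form, Finset.sum_eq_single i]
  · simp
  · intro j _ hj; simp [hj]
  · simp

theorem continuous_form : Continuous fun v : Amb n × Amb n => form n k v.1 v.2 := by
  unfold form; fun_prop

theorem isClosed_pseudoHyp : IsClosed (pseudoHyp n k) := by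
  have h1 : Continuous fun v : Amb n => form n k v v :=
    continuous_form.comp (continuous_id.prodMk continuous_id)
  exact (isClosed_eq h1 continuous_const).inter
    ((isClosed_eq (continuous_apply _) continuous_const).inter
      (isClosed_eq (continuous_apply _) continuous_const))

theorem isClosed_dom : IsClosed (dom n k) := isClosed_pseudoHyp.prod isClosed_univ

theorem idx₁_ne_idx₂ : idx₁ n ≠ idx₂ n := by simp [idx₁, idx₂]

/-- The vector `(0, …, 0, a, b)`. -/
def planeVec (n : ℕ) (a b : ℝ) : Amb n := Pi.single (idx₁ n) a + Pi.single (idx₂ n) b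

@[simp] theorem planeVec_idx₁ (a b : ℝ) : planeVec n a b (idx₁ n) = a := by
  simp [planeVec, idx₁_ne_idx₂]

@[simp] theorem planeVec_idx₂ (a b : ℝ) : planeVec n a b (idx₂ n) = b := by
  simp [planeVec, idx₁_ne_idx₂.symm]

theorem planeVec_smul (s a b : ℝ) : s • planeVec n a b = planeVec n (s * a) (s * b) := by
  simp [planeVec, smul_add, ← Pi.single_smul]

theorem form_planeVec_right (hk : k ≤ n) (v : Amb n) (a b : ℝ) :
    form n k v (planeVec n a b) = v (idx₁ n) * a + v (idx₂ n) * b := by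
  rw [planeVec, form_add_right, form_single_right, form_single_right]
  simp [idx₁, idx₂, hk, hk.trans (Nat.le_succ n), not_lt.2]

theorem form_add_planeVec (hk : k ≤ n) {v w : Amb n} (hv₁ : v (idx₁ n) = 0) (hv₂ : v (idx₂ n) = 0)
    (hw₁ : w (idx₁ n) = 0) (hw₂ : w (idx₂ n) = 0) (a b a' b' : ℝ) :
    form n k (v + planeVec n a b) (w + planeVec n a' b') = form n k v w + (a * a' + b * b') := by
  rw [form_add_right, form_planeVec_right hk, form_comm, form_add_right, form_planeVec_right hk,
    form_comm w]
  simp [hv₁, hv₂, hw₁, hw₂]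

theorem contDiff_planeVec {a b : ℝ → ℝ} (ha : ContDiff ℝ ∞ a) (hb : ContDiff ℝ ∞ b) :
    ContDiff ℝ ∞ fun u => planeVec n (a u) (b u) :=
  ((ContinuousLinearMap.single ℝ (fun _ : Fin (n + 2) => ℝ) (idx₁ n)).contDiff.comp ha).add
    ((ContinuousLinearMap.single ℝ (fun _ : Fin (n + 2) => ℝ) (idx₂ n)).contDiff.comp hb)

theorem hasDerivAt_planeVec {a b : ℝ → ℝ} {a' b' u : ℝ} (ha : HasDerivAt a a' u)
    (hb : HasDerivAt b b' u) :
    HasDerivAt (fun u => planeVec n (a u) (b u)) (planeVec n a' b') u :=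
  ((ContinuousLinearMap.single ℝ (fun _ : Fin (n + 2) => ℝ) (idx₁ n)).hasFDerivAt.comp_hasDerivAt
    u ha).add ((ContinuousLinearMap.single ℝ (fun _ : Fin (n + 2) => ℝ)
      (idx₂ n)).hasFDerivAt.comp_hasDerivAt u hb)

theorem contDiff_smul_add {a : ℝ → ℝ} {W : ℝ → Amb n} (ha : ContDiff ℝ ∞ a)
    (hW : ContDiff ℝ ∞ W) : ContDiff ℝ ∞ fun p : Amb n × ℝ => a p.2 • p.1 + W p.2 :=
  ((ha.comp contDiff_snd).smul contDiff_fst).add (hW.comp contDiff_snd)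

theorem fderiv_smul_add {a : ℝ → ℝ} {W : ℝ → Amb n} {a' : ℝ} {W' : Amb n} {p : Amb n × ℝ}
    (ha : HasDerivAt a a' p.2) (hW : HasDerivAt W W' p.2) (X : Amb n × ℝ) :
    fderiv ℝ (fun p : Amb n × ℝ => a p.2 • p.1 + W p.2) p X =
      a p.2 • X.1 + X.2 • (a' • p.1 + W') := by
  have h1 := ha.hasFDerivAt.comp p (hasFDerivAt_snd (𝕜 := ℝ) (E := Amb n) (F := ℝ) (p := p))
  have h2 := hW.hasFDerivAt.comp p (hasFDerivAt_snd (𝕜 := ℝ) (E := Amb n) (F := ℝ) (p := p))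
  have h3 := (h1.smul (hasFDerivAt_fst (𝕜 := ℝ) (E := Amb n) (F := ℝ) (p := p))).add h2
  have h4 : fderiv ℝ (fun p : Amb n × ℝ => a p.2 • p.1 + W p.2) p = _ := h3.fderiv
  rw [h4]
  simp [smul_add, smul_smul]
  abel

end Form

/-! ### Dimension of the tangent space and traces of diagonal endomorphisms -/

section Tangent

variable {n k : ℕ}

/-- The form as a linear functional of its first argument. -/
def formLeft (n k : ℕ) (w : Amb n) : Amb n →ₗ[ℝ] ℝ where
  toFun v := form n k v w
  map_add' v v' := form_add_left v v' w
  map_smul' a v := form_smul_left a v w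

theorem finrank_tangent (hk : k ≤ n) {p : Amb n × ℝ} (hp : p ∈ dom n k) :
    Module.finrank ℝ (tangent n k p) = n := by
  obtain ⟨⟨h1, h2, h3⟩, -⟩ := hp
  let L : Amb n × ℝ →ₗ[ℝ] ℝ × ℝ × ℝ :=
    ((formLeft n k p.1).prod ((LinearMap.proj (idx₁ n)).prod (LinearMap.proj (idx₂ n)))) ∘ₗ
      LinearMap.fst ℝ (Amb n) ℝ
  have hker : LinearMap.ker L = tangent n k p := by
    ext X
    simp [L, formLeft, tangent]
  have hrange : LinearMap.range L = ⊤ := by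
    rw [LinearMap.range_eq_top]
    rintro ⟨a, b, d⟩
    refine ⟨((-a) • p.1 + planeVec n b d, 0), ?_⟩
    have e : form n k ((-a) • p.1 + planeVec n b d) p.1 = a := by
      rw [form_comm, form_add_right, form_smul_right, h1, form_planeVec_right hk, h2, h3]; ring
    simpa [L, formLeft, h2, h3] using e
  have := LinearMap.finrank_range_add_finrank_ker L
  rw [hrange, hker, finrank_top] at this
  simp at this
  omega

/-- The endomorphism is l·id plus a rank-one correction along ∂ᵤ, so its trace is nl + (μ - l). -/
theorem exists_diagonal_endomorphism (hk : k ≤ n) {p : Amb n × ℝ} (hp : p ∈ dom n k) (l μ : ℝ) :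
    ∃ A : tangent n k p →ₗ[ℝ] tangent n k p,
      (∀ X : tangent n k p, (A X : Amb n × ℝ) = (l • (X : Amb n × ℝ).1, μ * (X : Amb n × ℝ).2)) ∧
      LinearMap.trace ℝ (tangent n k p) A = (n - 1) * l + μ := by
  let e : tangent n k p := ⟨(0, 1), by simp [tangent, form]⟩
  let f : tangent n k p →ₗ[ℝ] ℝ := LinearMap.snd ℝ (Amb n) ℝ ∘ₗ (tangent n k p).subtype
  refine ⟨l • LinearMap.id + (μ - l) • f.smulRight e, fun X => ?_, ?_⟩
  · ext1
    · simp [e, f]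
    · simp [e, f]; ring
  · rw [map_add, map_smul, map_smul, LinearMap.trace_id, LinearMap.trace_smulRight,
      finrank_tangent hk hp]
    simp [e, f]; ring

end Tangent

/-! ### Geometry of rotational hypersurfaces -/

/-- The first-order system satisfied by the radius `r`, its derivative `r₁`, the product `m` of the
radius with the repeated principal curvature, the remaining principal curvature `μ` and the
rotation angle `θ` of a rotational hypersurface of constant mean curvature `h`. -/
structure IsProfile (n : ℕ) (h : ℝ) (r r₁ m μ θ : ℝ → ℝ) : Prop where
  pos : ∀ u, 0 < r u
  contDiff_r : ContDiff ℝ ∞ r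
  contDiff_r₁ : ContDiff ℝ ∞ r₁
  contDiff_m : ContDiff ℝ ∞ m
  contDiff_θ : ContDiff ℝ ∞ θ
  hasDerivAt_r : ∀ u, HasDerivAt r (r₁ u) u
  hasDerivAt_r₁ : ∀ u, HasDerivAt r₁ (μ u * m u - r u) u
  hasDerivAt_m : ∀ u, HasDerivAt m (μ u * r₁ u) u
  hasDerivAt_θ : ∀ u, HasDerivAt θ (m u / (r u ^ 2 + 1)) u
  energy : ∀ u, r₁ u ^ 2 = m u ^ 2 - r u ^ 2 - 1
  mean : ∀ u, (n - 1) * (m u / r u) + μ u = n * h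

/-- The rotational hypersurface with radius `r` and angle `θ`. -/
def rotation (n : ℕ) (r θ : ℝ → ℝ) (p : Amb n × ℝ) : Amb n :=
  r p.2 • p.1 + √(r p.2 ^ 2 + 1) • B₂ n (θ p.2)

namespace IsProfile

variable {n k : ℕ} {h : ℝ} {r r₁ m μ θ : ℝ → ℝ} (H : IsProfile n h r r₁ m μ θ)

theorem rotation_eq (r θ : ℝ → ℝ) : rotation n r θ = fun p : Amb n × ℝ => r p.2 • p.1 +
    planeVec n (√(r p.2 ^ 2 + 1) * Real.cos (θ p.2)) (√(r p.2 ^ 2 + 1) * Real.sin (θ p.2)) := by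
  funext p; rw [← planeVec_smul]; rfl

/-- The plane component of the derivative of the rotational hypersurface along `u`. -/
def planeDeriv (n : ℕ) (r r₁ m θ : ℝ → ℝ) (u : ℝ) : Amb n :=
  planeVec n
    (r u * r₁ u / √(r u ^ 2 + 1) * Real.cos (θ u) - m u / √(r u ^ 2 + 1) * Real.sin (θ u))
    (r u * r₁ u / √(r u ^ 2 + 1) * Real.sin (θ u) + m u / √(r u ^ 2 + 1) * Real.cos (θ u))

/-- The unit normal field of the rotational hypersurface. -/
def normal (n : ℕ) (r r₁ m θ : ℝ → ℝ) (p : Amb n × ℝ) : Amb n :=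
  (-m p.2) • p.1 + planeVec n
    (-(r p.2 * m p.2 / √(r p.2 ^ 2 + 1) * Real.cos (θ p.2) -
      r₁ p.2 / √(r p.2 ^ 2 + 1) * Real.sin (θ p.2)))
    (-(r p.2 * m p.2 / √(r p.2 ^ 2 + 1) * Real.sin (θ p.2) +
      r₁ p.2 / √(r p.2 ^ 2 + 1) * Real.cos (θ p.2)))

include H

theorem contDiff_rho : ContDiff ℝ ∞ fun u => √(r u ^ 2 + 1) :=
  ((H.contDiff_r.pow 2).add contDiff_const).sqrt fun u => by positivity

theorem hasDerivAt_rho (u : ℝ) :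
    HasDerivAt (fun u => √(r u ^ 2 + 1)) (r u * r₁ u / √(r u ^ 2 + 1)) u := by
  have h1 := (((H.hasDerivAt_r u).pow 2).add_const 1).sqrt (by simp only [Pi.pow_apply]; positivity)
  refine h1.congr_deriv ?_
  simp only [Pi.pow_apply]
  push_cast
  field_simp

theorem contDiff_rotation : ContDiff ℝ ∞ (rotation n r θ) := by
  rw [rotation_eq]
  exact contDiff_smul_add H.contDiff_r (contDiff_planeVec
    (H.contDiff_rho.mul (Real.contDiff_cos.comp H.contDiff_θ))
    (H.contDiff_rho.mul (Real.contDiff_sin.comp H.contDiff_θ)))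

theorem fderiv_rotation (p X : Amb n × ℝ) : fderiv ℝ (rotation n r θ) p X =
    r p.2 • X.1 + X.2 • (r₁ p.2 • p.1 + planeDeriv n r r₁ m θ p.2) := by
  have hs : 0 < √(r p.2 ^ 2 + 1) := Real.sqrt_pos.2 (by positivity)
  have hs2 : √(r p.2 ^ 2 + 1) ^ 2 = r p.2 ^ 2 + 1 := Real.sq_sqrt (by positivity)
  rw [rotation_eq]
  refine fderiv_smul_add (W := fun u => planeVec n (√(r u ^ 2 + 1) * Real.cos (θ u))
    (√(r u ^ 2 + 1) * Real.sin (θ u))) (H.hasDerivAt_r p.2) (hasDerivAt_planeVec ?_ ?_) X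
  · refine ((H.hasDerivAt_rho p.2).mul (H.hasDerivAt_θ p.2).cos).congr_deriv ?_
    generalize √(r p.2 ^ 2 + 1) = s at hs hs2 ⊢
    rw [← hs2]; field_simp; ring
  · refine ((H.hasDerivAt_rho p.2).mul (H.hasDerivAt_θ p.2).sin).congr_deriv ?_
    generalize √(r p.2 ^ 2 + 1) = s at hs hs2 ⊢
    rw [← hs2]; field_simp

theorem contDiff_normal : ContDiff ℝ ∞ (normal n r r₁ m θ) := by
  have hne : ∀ u, √(r u ^ 2 + 1) ≠ 0 := fun u => (Real.sqrt_pos.2 (by positivity)).ne'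
  have h1 : ContDiff ℝ ∞ fun u => r u * m u / √(r u ^ 2 + 1) :=
    (H.contDiff_r.mul H.contDiff_m).div H.contDiff_rho hne
  have h2 : ContDiff ℝ ∞ fun u => r₁ u / √(r u ^ 2 + 1) := H.contDiff_r₁.div H.contDiff_rho hne
  have hc := Real.contDiff_cos.comp H.contDiff_θ
  have hs := Real.contDiff_sin.comp H.contDiff_θ
  exact contDiff_smul_add H.contDiff_m.neg (contDiff_planeVec
    ((h1.mul hc).sub (h2.mul hs)).neg ((h1.mul hs).add (h2.mul hc)).neg)

theorem fderiv_normal (p X : Amb n × ℝ) : fderiv ℝ (normal n r r₁ m θ) p X =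
    -(m p.2 • X.1 + (μ p.2 * X.2) • (r₁ p.2 • p.1 + planeDeriv n r r₁ m θ p.2)) := by
  set u := p.2 with hu
  have hs : 0 < √(r u ^ 2 + 1) := Real.sqrt_pos.2 (by positivity)
  have hs2 : √(r u ^ 2 + 1) ^ 2 = r u ^ 2 + 1 := Real.sq_sqrt (by positivity)
  -- In the frame B₂(θ), B₂'(θ), the terms with θ' = m/(r²+1) in `h1` and `h2` cancel those produced
  -- by the rotation of the frame. This leaves μ times the plane part of ∂ᵤφ.
  have h1 : HasDerivAt (fun u => r u * m u / √(r u ^ 2 + 1))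
      (μ u * (r u * r₁ u / √(r u ^ 2 + 1)) +
        r₁ u / √(r u ^ 2 + 1) * (m u / (r u ^ 2 + 1))) u := by
    refine (((H.hasDerivAt_r u).mul (H.hasDerivAt_m u)).div (H.hasDerivAt_rho u)
      hs.ne').congr_deriv ?_
    simp only [Pi.mul_apply]
    generalize √(r u ^ 2 + 1) = s at hs hs2 ⊢
    rw [← hs2]
    field_simp
    linear_combination (r₁ u * m u) * hs2
  have h2 : HasDerivAt (fun u => r₁ u / √(r u ^ 2 + 1))
      (μ u * (m u / √(r u ^ 2 + 1)) -
        r u * m u / √(r u ^ 2 + 1) * (m u / (r u ^ 2 + 1))) u := by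
    refine ((H.hasDerivAt_r₁ u).div (H.hasDerivAt_rho u) hs.ne').congr_deriv ?_
    generalize √(r u ^ 2 + 1) = s at hs hs2 ⊢
    rw [← hs2]
    field_simp
    linear_combination (-r u) * hs2 - r u * H.energy u
  have hθ := H.hasDerivAt_θ u
  have h3 := fderiv_smul_add (n := n) (p := p) (H.hasDerivAt_m u).neg
    (hasDerivAt_planeVec ((h1.mul hθ.cos).sub (h2.mul hθ.sin)).neg
      ((h1.mul hθ.sin).add (h2.mul hθ.cos)).neg) X
  refine Eq.trans h3 ?_
  have h4 : ∀ A B A' B', A = -(μ u * A') → B = -(μ u * B') →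
      planeVec n A B = -(μ u • planeVec n A' B') := by
    rintro _ _ A' B' rfl rfl
    rw [← neg_smul, planeVec_smul, neg_mul, neg_mul]
  rw [h4 _ _ (r u * r₁ u / √(r u ^ 2 + 1) * Real.cos (θ u) - m u / √(r u ^ 2 + 1) * Real.sin (θ u))
    (r u * r₁ u / √(r u ^ 2 + 1) * Real.sin (θ u) + m u / √(r u ^ 2 + 1) * Real.cos (θ u))
    (by ring) (by ring)]
  simp only [planeDeriv, Pi.neg_apply, neg_smul, smul_add, smul_neg, smul_smul, mul_comm X.2,
    neg_add, mul_assoc]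
  rfl

omit H in
theorem rotation_mem (hk : k ≤ n) {p : Amb n × ℝ} (hp : p ∈ dom n k) :
    rotation n r θ p ∈ pseudoSphere n k := by
  obtain ⟨⟨h1, h2, h3⟩, -⟩ := hp
  have hs2 : √(r p.2 ^ 2 + 1) ^ 2 = r p.2 ^ 2 + 1 := Real.sq_sqrt (by positivity)
  rw [rotation_eq, pseudoSphere, mem_ofPred_eq, form_add_planeVec hk (by simp [h2]) (by simp [h3])
    (by simp [h2]) (by simp [h3]), form_smul_left, form_smul_right, h1]
  linear_combination hs2 + √(r p.2 ^ 2 + 1) ^ 2 * Real.cos_sq_add_sin_sq (θ p.2)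

/-- The induced metric is the warped product r²⟨,⟩ + du². The mixed terms vanish because ⟨X, y⟩ = 0,
and ∂ᵤφ has unit length exactly by `energy`. -/
theorem form_fderiv_rotation (hk : k ≤ n) {p : Amb n × ℝ} (hp : p ∈ dom n k) {X Y : Amb n × ℝ}
    (hX : X ∈ tangent n k p) (hY : Y ∈ tangent n k p) :
    form n k (fderiv ℝ (rotation n r θ) p X) (fderiv ℝ (rotation n r θ) p Y) =
      r p.2 ^ 2 * form n k X.1 Y.1 + X.2 * Y.2 := by
  obtain ⟨⟨h1, h2, h3⟩, -⟩ := hp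
  obtain ⟨x1, x2, x3⟩ := hX
  obtain ⟨y1, y2, y3⟩ := hY
  have hs : 0 < √(r p.2 ^ 2 + 1) := Real.sqrt_pos.2 (by positivity)
  have hs2 : √(r p.2 ^ 2 + 1) ^ 2 = r p.2 ^ 2 + 1 := Real.sq_sqrt (by positivity)
  have e : ∀ Z : Amb n × ℝ, r p.2 • Z.1 + Z.2 • (r₁ p.2 • p.1 + planeDeriv n r r₁ m θ p.2) =
      (r p.2 • Z.1 + (Z.2 * r₁ p.2) • p.1) + Z.2 • planeDeriv n r r₁ m θ p.2 := fun Z => by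
    rw [smul_add, smul_smul, add_assoc]
  rw [H.fderiv_rotation, H.fderiv_rotation, e, e, planeDeriv, planeVec_smul, planeVec_smul,
    form_add_planeVec hk (by simp [h2, x2]) (by simp [h3, x3]) (by simp [h2, y2])
      (by simp [h3, y3])]
  simp only [form_add_left, form_add_right, form_smul_left, form_smul_right, form_comm p.1 Y.1, x1,
    y1, h1]
  have key : (r p.2 * r₁ p.2 / √(r p.2 ^ 2 + 1)) ^ 2 + (m p.2 / √(r p.2 ^ 2 + 1)) ^ 2 =
      1 + r₁ p.2 ^ 2 := by
    rw [div_pow, div_pow, hs2]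
    field_simp
    linear_combination (-1 : ℝ) * H.energy p.2
  linear_combination X.2 * Y.2 * key + X.2 * Y.2 *
    ((r p.2 * r₁ p.2 / √(r p.2 ^ 2 + 1)) ^ 2 + (m p.2 / √(r p.2 ^ 2 + 1)) ^ 2) *
      Real.cos_sq_add_sin_sq (θ p.2)

/-- The metric may be indefinite, so a kernel vector is paired with ∂ᵤ to kill its u-component. The
rest is r·X = 0 with r > 0. -/
theorem isImmersion (hk : k ≤ n) : IsImmersion n k (rotation n r θ) := by
  refine ⟨H.contDiff_rotation, fun p hp => ⟨rotation_mem hk hp, fun X hX h0 => ?_⟩⟩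
  have hT : ((0 : Amb n), (1 : ℝ)) ∈ tangent n k p := by simp [tangent, form]
  have h1 := H.form_fderiv_rotation hk hp hX hT
  rw [h0] at h1
  have h2 : X.2 = 0 := by simpa [form] using h1.symm
  rw [H.fderiv_rotation, h2, zero_smul, add_zero] at h0
  exact Prod.ext ((smul_eq_zero.1 h0).resolve_left (H.pos _).ne') h2

theorem hasConstantMeanCurvature (hk : k ≤ n) :
    HasConstantMeanCurvature n k (rotation n r θ) h := by
  refine ⟨normal n r r₁ m θ, H.contDiff_normal, fun p hp => ?_⟩
  have hp' := hp
  obtain ⟨⟨h1, h2, h3⟩, -⟩ := hp'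
  have hs : 0 < √(r p.2 ^ 2 + 1) := Real.sqrt_pos.2 (by positivity)
  have hs2 : √(r p.2 ^ 2 + 1) ^ 2 = r p.2 ^ 2 + 1 := Real.sq_sqrt (by positivity)
  have hcs := Real.cos_sq_add_sin_sq (θ p.2)
  refine ⟨?_, ?_, fun X hX => ?_, ?_⟩
  · rw [normal, form_add_planeVec hk (by simp [h2]) (by simp [h3]) (by simp [h2]) (by simp [h3]),
      form_smul_left, form_smul_right, h1]
    have key : (r p.2 * m p.2 / √(r p.2 ^ 2 + 1)) ^ 2 + (r₁ p.2 / √(r p.2 ^ 2 + 1)) ^ 2 =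
        m p.2 ^ 2 - 1 := by
      rw [div_pow, div_pow, hs2]
      field_simp
      linear_combination H.energy p.2
    rw [abs_eq zero_le_one]
    -- The unit normal is timelike: ⟨ν, ν⟩ = -1.
    right
    linear_combination key + ((r p.2 * m p.2 / √(r p.2 ^ 2 + 1)) ^ 2 +
      (r₁ p.2 / √(r p.2 ^ 2 + 1)) ^ 2) * hcs
  · rw [normal, rotation_eq, form_add_planeVec hk (by simp [h2]) (by simp [h3]) (by simp [h2])
      (by simp [h3]), form_smul_left, form_smul_right, h1]
    field_simp
    linear_combination (-(r p.2 * m p.2)) * hcs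
  · obtain ⟨x1, x2, x3⟩ := hX
    rw [H.fderiv_rotation, smul_add, smul_smul, ← add_assoc, planeDeriv, planeVec_smul, normal,
      form_add_planeVec hk (by simp [h2]) (by simp [h3]) (by simp [h2, x2]) (by simp [h3, x3])]
    simp only [form_add_right, form_smul_left, form_smul_right, form_comm p.1 X.1, x1, h1]
    field_simp
    rw [hs2]
    linear_combination (-(X.2 * m p.2 * r₁ p.2 * (r p.2 ^ 2 + 1))) * hcs
  · obtain ⟨A, hA, htr⟩ := exists_diagonal_endomorphism hk hp (m p.2 / r p.2) (μ p.2)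
    refine ⟨A, fun X => ?_, by rw [htr, H.mean]⟩
    have hr := (H.pos p.2).ne'
    rw [hA, H.fderiv_normal, H.fderiv_rotation, smul_smul, mul_div_cancel₀ _ hr]

theorem isProperMap (hr : Tendsto r (cocompact ℝ) atTop) :
    IsProperMap ((dom n k).domRestrict (rotation n r θ)) := by
  have hcont : Continuous ((dom n k).domRestrict (rotation n r θ)) :=
    H.contDiff_rotation.continuous.comp continuous_subtype_val
  refine isProperMap_iff_isCompact_preimage.2 ⟨hcont, fun K hK => ?_⟩
  obtain ⟨M, hM0, hM⟩ := hK.isBounded.exists_pos_norm_le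
  -- In the sup norm each of the last two coordinates is at most M, so r² + 1 ≤ 2M². This bounds u,
  -- and a positive lower bound for r on C then bounds y.
  obtain ⟨C, hC, hCr⟩ := mem_cocompact.1 (hr.eventually_gt_atTop (2 * M ^ 2 + 1))
  obtain ⟨r₀, hr₀, hle⟩ := hC.exists_forall_le' H.contDiff_r.continuous.continuousOn
    (a := 0) fun u _ => H.pos u
  refine (isClosed_dom.isClosedEmbedding_subtypeVal.isCompact_preimage
    ((isCompact_closedBall (0 : Amb n) (M / r₀)).prod hC)).of_isClosed_subset
    (hK.isClosed.preimage hcont) ?_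
  rintro ⟨⟨y, u⟩, ⟨h1, h2, h3⟩, hv⟩ hp
  have hx : rotation n r θ (y, u) ∈ K := hp
  rw [rotation_eq] at hx
  have hb := hM _ hx
  rw [pi_norm_le_iff_of_nonneg hM0.le] at hb
  simp only at h2 h3 hb
  have hs2 : √(r u ^ 2 + 1) ^ 2 = r u ^ 2 + 1 := Real.sq_sqrt (by positivity)
  have hu : u ∈ C := by
    by_contra hu
    have h4 : 2 * M ^ 2 + 1 < r u := hCr hu
    have b1 := hb (idx₁ n)
    have b2 := hb (idx₂ n)
    simp only [Pi.add_apply, Pi.smul_apply, h2, h3, planeVec_idx₁, planeVec_idx₂, smul_zero,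
      zero_add, Real.norm_eq_abs] at b1 b2
    have c1 := sq_le_sq' (abs_le.1 b1).1 (abs_le.1 b1).2
    have c2 := sq_le_sq' (abs_le.1 b2).1 (abs_le.1 b2).2
    have c3 : r u ^ 2 + 1 ≤ 2 * M ^ 2 := by
      have := Real.cos_sq_add_sin_sq (θ u)
      rw [mul_pow, hs2] at c1 c2
      nlinarith
    nlinarith [sq_nonneg M]
  refine ⟨?_, hu⟩
  rw [mem_closedBall_zero_iff, pi_norm_le_iff_of_nonneg (by positivity)]
  intro i
  by_cases hi₁ : i = idx₁ n
  · simp only [hi₁, h2, norm_zero]; positivity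
  by_cases hi₂ : i = idx₂ n
  · simp only [hi₂, h3, norm_zero]; positivity
  have b := hb i
  simp only [planeVec, Pi.add_apply, Pi.smul_apply, smul_eq_mul, Pi.single_eq_of_ne hi₁,
    Pi.single_eq_of_ne hi₂, add_zero, norm_mul, Real.norm_eq_abs, abs_of_pos (H.pos u)] at b
  rw [le_div_iff₀ hr₀, Real.norm_eq_abs]
  have := mul_le_mul_of_nonneg_right (hle u hu) (abs_nonneg (y i))
  linarith

theorem isClosedImmersion (hk : k ≤ n) (hr : Tendsto r (cocompact ℝ) atTop) :
    IsClosedImmersion n k (rotation n r θ) :=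
  ⟨H.isImmersion hk, H.isProperMap hr⟩

/-- If the rotation angle is injective modulo `2 π`, the hypersurface is embedded. -/
theorem isEmbedded (hk : k ≤ n) (hr : Tendsto r (cocompact ℝ) atTop)
    (hθ : ∀ u v, u < v → θ u < θ v ∧ θ v < θ u + 2 * Real.pi) :
    IsEmbedded n k (rotation n r θ) := by
  have hproper := H.isProperMap (n := n) (k := k) hr
  refine ⟨H.isImmersion hk, (IsClosedEmbedding.of_continuous_injective_isClosedMap
    hproper.continuous ?_ hproper.isClosedMap).isEmbedding⟩
  have hB : ∀ u v, u < v → Real.cos (θ u) = Real.cos (θ v) → Real.sin (θ u) = Real.sin (θ v) →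
      False := fun u v huv hc hs => by
    obtain ⟨h1, h2⟩ := hθ u v huv
    have h3 : Real.cos (θ v - θ u) = 1 := by
      rw [Real.cos_sub, hc, hs, ← sq, ← sq, Real.cos_sq_add_sin_sq]
    have := (Real.cos_eq_one_iff_of_lt_of_lt (by linarith [Real.pi_pos]) (by linarith)).1 h3
    linarith
  rintro ⟨⟨y, u⟩, ⟨h1, h2, h3⟩, hv⟩ ⟨⟨y', u'⟩, ⟨h1', h2', h3'⟩, hv'⟩ heq
  have heq' : rotation n r θ (y, u) = rotation n r θ (y', u') := heq
  rw [rotation_eq] at heq'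
  simp only at heq' h2 h3 h2' h3'
  have c1 := congrFun heq' (idx₁ n)
  have c2 := congrFun heq' (idx₂ n)
  simp only [Pi.add_apply, Pi.smul_apply, h2, h3, h2', h3', planeVec_idx₁, planeVec_idx₂, smul_zero,
    zero_add] at c1 c2
  have hs : 0 < √(r u ^ 2 + 1) := Real.sqrt_pos.2 (by positivity)
  have hs' : 0 < √(r u' ^ 2 + 1) := Real.sqrt_pos.2 (by positivity)
  have hrho : √(r u ^ 2 + 1) = √(r u' ^ 2 + 1) := by
    refine (sq_eq_sq₀ hs.le hs'.le).1 ?_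
    have e1 := Real.cos_sq_add_sin_sq (θ u)
    have e2 := Real.cos_sq_add_sin_sq (θ u')
    calc √(r u ^ 2 + 1) ^ 2 = (√(r u ^ 2 + 1) * Real.cos (θ u)) ^ 2 +
          (√(r u ^ 2 + 1) * Real.sin (θ u)) ^ 2 := by
            linear_combination (-√(r u ^ 2 + 1) ^ 2) * e1
      _ = √(r u' ^ 2 + 1) ^ 2 := by
            rw [c1, c2]; linear_combination (√(r u' ^ 2 + 1) ^ 2) * e2
  rw [hrho] at c1 c2
  have hcos := mul_left_cancel₀ hs'.ne' c1
  have hsin := mul_left_cancel₀ hs'.ne' c2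
  obtain rfl : u = u' := by
    rcases lt_trichotomy u u' with hlt | rfl | hlt
    · exact (hB _ _ hlt hcos hsin).elim
    · rfl
    · exact (hB _ _ hlt hcos.symm hsin.symm).elim
  obtain rfl : y = y' := smul_right_injective _ (H.pos u).ne' (add_right_cancel heq')
  rfl

end IsProfile

/-! ### Lorentzian inequalities on the hyperboloid (k = 1) -/

section Lorentz

variable {n : ℕ}

theorem form_one (v w : Amb n) :
    form n 1 v w = -(v 0 * w 0) + ∑ j : Fin (n + 1), v j.succ * w j.succ := by
  rw [form, Fin.sum_univ_succ]
  simp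

/-- Cauchy–Schwarz for the spatial parts, where orthogonality gives Σ vⱼyⱼ = v₀y₀ and Σ yⱼ² = y₀² -
1. -/
theorem sum_sq_le_form {y v : Amb n} (hy : form n 1 y y = -1) (hv : form n 1 v y = 0) :
    ∑ j : Fin (n + 1), v j.succ ^ 2 ≤ y 0 ^ 2 * form n 1 v v := by
  rw [form_one] at hy hv ⊢
  have hcs := Finset.sum_mul_sq_le_sq_mul_sq Finset.univ (fun j : Fin (n + 1) => v j.succ)
    (fun j => y j.succ)
  simp only [← sq] at hy ⊢
  have e1 : ∑ j : Fin (n + 1), y j.succ ^ 2 = y 0 ^ 2 - 1 := by linarith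
  have e2 : ∑ j : Fin (n + 1), v j.succ * y j.succ = v 0 * y 0 := by linarith
  rw [e1, e2] at hcs
  nlinarith

theorem one_le_sq_zero {y : Amb n} (hy : form n 1 y y = -1) : 1 ≤ y 0 ^ 2 := by
  rw [form_one] at hy
  have : 0 ≤ ∑ j : Fin (n + 1), y j.succ * y j.succ :=
    Finset.sum_nonneg fun j _ => mul_self_nonneg _
  nlinarith

theorem form_nonneg {y v : Amb n} (hy : form n 1 y y = -1) (hv : form n 1 v y = 0) :
    0 ≤ form n 1 v v := by
  have h1 : 0 ≤ ∑ j : Fin (n + 1), v j.succ ^ 2 := Finset.sum_nonneg fun j _ => sq_nonneg _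
  have h2 := one_le_sq_zero hy
  exact nonneg_of_mul_nonneg_right (h1.trans (sum_sq_le_form hy hv)) (by linarith)

theorem form_pos {y v : Amb n} (hy : form n 1 y y = -1) (hv : form n 1 v y = 0) (h0 : v ≠ 0) :
    0 < form n 1 v v := by
  refine (form_nonneg hy hv).lt_of_ne fun hz => h0 ?_
  have h1 := sum_sq_le_form hy hv
  rw [← hz, mul_zero] at h1
  have h2 : ∀ j : Fin (n + 1), v j.succ = 0 := fun j => by
    have := (Finset.sum_eq_zero_iff_of_nonneg fun j _ => sq_nonneg (v (Fin.succ j))).1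
      (h1.antisymm (Finset.sum_nonneg fun j _ => sq_nonneg _)) j (Finset.mem_univ j)
    exact pow_eq_zero_iff two_ne_zero |>.1 this
  rw [form_one] at hz
  simp only [h2, mul_zero, Finset.sum_const_zero, add_zero] at hz
  have h3 : v 0 = 0 := by simpa using hz
  funext i
  exact Fin.cases h3 h2 i

/-- This says that arsinh(yᵢ) is 1-Lipschitz on the hyperboloid. For spatial i it is Cauchy–Schwarz
in y^⊥ against eᵢ + yᵢy, the projection of eᵢ, whose square is 1 + yᵢ². -/
theorem sq_apply_le_form {y v : Amb n} (hy : form n 1 y y = -1) (hv : form n 1 v y = 0)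
    (i : Fin (n + 2)) : v i ^ 2 ≤ (1 + y i ^ 2) * form n 1 v v := by
  have hF := form_nonneg hy hv
  induction i using Fin.cases with
  | zero =>
    have h1 := sum_sq_le_form hy hv
    have h2 : ∑ j : Fin (n + 1), v j.succ ^ 2 = form n 1 v v + v 0 ^ 2 := by
      rw [form_one]; simp only [← sq]; ring
    rw [h2] at h1
    nlinarith
  | succ j =>
    set i := j.succ with hi
    have hs : ∀ w : Amb n, form n 1 w (Pi.single i 1) = w i := fun w => by
      rw [form_single_right]; simp [hi]
    have hs' : ∀ w : Amb n, form n 1 (Pi.single i 1) w = w i := fun w => by rw [form_comm, hs]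
    have hyv : form n 1 y v = 0 := by rw [form_comm, hv]
    have h1 := form_nonneg (v := (1 + y i ^ 2) • v + (-v i) • (Pi.single i 1 + y i • y)) hy (by
      simp only [form_add_left, form_smul_left, hv, hs', hy]; ring)
    simp only [form_add_left, form_smul_left, form_add_right, form_smul_right, hv, hyv, hs, hs', hy,
      Pi.add_apply, Pi.smul_apply, smul_eq_mul, Pi.single_eq_same] at h1
    have h2 : 0 ≤ (1 + y i ^ 2) * ((1 + y i ^ 2) * form n 1 v v - v i ^ 2) := by linarith
    have := nonneg_of_mul_nonneg_right h2 (by positivity : 0 < 1 + y i ^ 2)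
    linarith

end Lorentz

/-! ### Lengths of curves and completeness -/

section Curves

variable {n k : ℕ}

theorem derivWithin_mem_tangent {γ : ℝ → Amb n × ℝ} (hγ : ContDiffOn ℝ 1 γ (Icc 0 1))
    (hdom : ∀ t ∈ Icc (0 : ℝ) 1, γ t ∈ dom n k) {t : ℝ} (ht : t ∈ Icc (0 : ℝ) 1) :
    derivWithin γ (Icc 0 1) t ∈ tangent n k (γ t) := by
  have hu := uniqueDiffOn_Icc (zero_lt_one (α := ℝ)) t ht
  have h1 : HasDerivWithinAt γ (derivWithin γ (Icc 0 1) t) (Icc 0 1) t :=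
    (hγ.differentiableOn one_ne_zero t ht).hasDerivWithinAt
  set X := derivWithin γ (Icc 0 1) t
  have h2 : ∀ i, HasDerivWithinAt (fun t => (γ t).1 i) (X.1 i) (Icc 0 1) t :=
    hasDerivWithinAt_pi.1 h1.fst
  have hconst : ∀ (a : ℝ) (f : ℝ → ℝ) (f' : ℝ), (∀ t ∈ Icc (0 : ℝ) 1, f t = a) →
      HasDerivWithinAt f f' (Icc 0 1) t → f' = 0 := fun a f f' hf hf' =>
    hu.eq_deriv _ (hf'.congr_of_mem (fun x hx => (hf x hx).symm) ht)
      (hasDerivWithinAt_const t (Icc 0 1) a)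
  refine ⟨?_, hconst 0 _ _ (fun s hs => (hdom s hs).1.2.1) (h2 _),
    hconst 0 _ _ (fun s hs => (hdom s hs).1.2.2) (h2 _)⟩
  have h3 := HasDerivWithinAt.fun_sum (u := Finset.univ) (fun (i : Fin (n + 2)) _ =>
    ((h2 i).const_mul (if (i : ℕ) < k then (-1 : ℝ) else 1)).mul (h2 i))
  have h4 := hconst (-1) _ _ (fun s hs => (hdom s hs).1.1) h3
  have h5 : ∑ i : Fin (n + 2), ((if (i : ℕ) < k then (-1 : ℝ) else 1) * X.1 i * (γ t).1 i +
      (if (i : ℕ) < k then (-1 : ℝ) else 1) * (γ t).1 i * X.1 i) =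
      2 * form n k X.1 (γ t).1 := by
    rw [form, Finset.mul_sum]
    exact Finset.sum_congr rfl fun i _ => by ring
  linarith [h4.symm.trans h5]

theorem enorm_sub_le_curveLength {φ : Amb n × ℝ → Amb n} {γ : ℝ → Amb n × ℝ} {f : ℝ → ℝ}
    (hf : ContDiffOn ℝ 1 f (Icc 0 1))
    (hle : ∀ t ∈ Icc (0 : ℝ) 1, |derivWithin f (Icc 0 1) t| ≤ √(inducedMetric n k φ (γ t)
      (derivWithin γ (Icc 0 1) t) (derivWithin γ (Icc 0 1) t))) :
    ‖f 1 - f 0‖ₑ ≤ curveLength n k φ γ := by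
  refine (enorm_sub_le_lintegral_derivWithin_Icc_of_contDiffOn_Icc hf zero_le_one).trans ?_
  refine setLIntegral_mono' measurableSet_Icc fun t ht => ?_
  rw [← ofReal_norm]
  exact ENNReal.ofReal_le_ofReal (hle t ht)

end Curves

namespace IsProfile

variable {n : ℕ} {h : ℝ} {r r₁ m μ θ : ℝ → ℝ} (H : IsProfile n h r r₁ m μ θ)

include H

theorem isSpacelike (hn : 1 ≤ n) : IsSpacelike n 1 (rotation n r θ) := by
  intro p hp X hX h0
  rw [inducedMetric, H.form_fderiv_rotation hn hp hX hX]
  have hr := H.pos p.2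
  rcases eq_or_ne X.1 0 with h1 | h1
  · have h2 : X.2 ≠ 0 := fun h2 => h0 (Prod.ext h1 h2)
    have := mul_self_pos.2 h2
    have := form_nonneg hp.1.1 hX.1
    positivity
  · have h2 := form_pos hp.1.1 hX.1 h1
    have := mul_self_nonneg X.2
    positivity

theorem enorm_sub_le_inducedDist (hn : 1 ≤ n) {r₀ : ℝ} (hr₀ : 0 < r₀) (hle : ∀ u, r₀ ≤ r u)
    (p q : Amb n × ℝ) :
    ‖q.2 - p.2‖ₑ ≤ inducedDist n 1 (rotation n r θ) p q ∧
    ∀ i, ‖r₀ * Real.arsinh (q.1 i) - r₀ * Real.arsinh (p.1 i)‖ₑ ≤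
      inducedDist n 1 (rotation n r θ) p q := by
  have key : ∀ γ : ℝ → Amb n × ℝ, ContDiffOn ℝ 1 γ (Icc 0 1) →
      (∀ t ∈ Icc (0 : ℝ) 1, γ t ∈ dom n 1) → ∀ t ∈ Icc (0 : ℝ) 1,
      inducedMetric n 1 (rotation n r θ) (γ t) (derivWithin γ (Icc 0 1) t)
        (derivWithin γ (Icc 0 1) t) =
      r (γ t).2 ^ 2 * form n 1 (derivWithin γ (Icc 0 1) t).1 (derivWithin γ (Icc 0 1) t).1 +
        (derivWithin γ (Icc 0 1) t).2 * (derivWithin γ (Icc 0 1) t).2 := fun γ h1 h2 t ht =>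
    H.form_fderiv_rotation hn (h2 t ht) (derivWithin_mem_tangent h1 h2 ht)
      (derivWithin_mem_tangent h1 h2 ht)
  refine ⟨le_iInf₂ fun γ hγ => ?_, fun i => le_iInf₂ fun γ hγ => ?_⟩
  all_goals
    obtain ⟨h1, h2, rfl, rfl⟩ := hγ
    have hd : ∀ t ∈ Icc (0 : ℝ) 1, HasDerivWithinAt γ (derivWithin γ (Icc 0 1) t) (Icc 0 1) t :=
      fun t ht => (h1.differentiableOn one_ne_zero t ht).hasDerivWithinAt
  · refine enorm_sub_le_curveLength (f := fun t => (γ t).2) h1.snd fun t ht => ?_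
    have h3 : HasDerivWithinAt (fun t => (γ t).2) _ _ t := (hd t ht).snd
    rw [key γ h1 h2 t ht, h3.derivWithin (uniqueDiffOn_Icc zero_lt_one t ht)]
    refine Real.abs_le_sqrt ?_
    have := form_nonneg (h2 t ht).1.1 (derivWithin_mem_tangent h1 h2 ht).1
    have := mul_nonneg (sq_nonneg (r (γ t).2)) this
    linarith
  · have h3 : ContDiffOn ℝ 1 (fun t => (γ t).1 i) (Icc 0 1) := contDiffOn_pi.1 h1.fst i
    refine enorm_sub_le_curveLength (f := fun t => r₀ * Real.arsinh ((γ t).1 i))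
      (contDiffOn_const.mul h3.arsinh) fun t ht => ?_
    have hT := derivWithin_mem_tangent h1 h2 ht
    have h4 := (((hasDerivWithinAt_pi.1 (hd t ht).fst i).arsinh).const_mul r₀).derivWithin
      (uniqueDiffOn_Icc zero_lt_one t ht)
    rw [key γ h1 h2 t ht, h4]
    refine Real.abs_le_sqrt ?_
    set X := derivWithin γ (Icc 0 1) t
    have h5 := sq_apply_le_form (h2 t ht).1.1 hT.1 i
    have h6 := form_nonneg (h2 t ht).1.1 hT.1
    have h7 : 0 < 1 + (γ t).1 i ^ 2 := by positivity
    have h8 : (√(1 + (γ t).1 i ^ 2))⁻¹ ^ 2 * X.1 i ^ 2 ≤ form n 1 X.1 X.1 := by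
      rw [inv_pow, Real.sq_sqrt h7.le, inv_mul_le_iff₀ h7]
      exact h5
    have h9 : r₀ ^ 2 ≤ r (γ t).2 ^ 2 := pow_le_pow_left₀ hr₀.le (hle _) 2
    calc (r₀ * ((√(1 + (γ t).1 i ^ 2))⁻¹ • X.1 i)) ^ 2
        = r₀ ^ 2 * ((√(1 + (γ t).1 i ^ 2))⁻¹ ^ 2 * X.1 i ^ 2) := by
          rw [smul_eq_mul]; ring
      _ ≤ r₀ ^ 2 * form n 1 X.1 X.1 := mul_le_mul_of_nonneg_left h8 (sq_nonneg _)
      _ ≤ r (γ t).2 ^ 2 * form n 1 X.1 X.1 := mul_le_mul_of_nonneg_right h9 h6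
      _ ≤ _ := le_add_of_nonneg_right (mul_self_nonneg _)

/-- The comparison curve is a straight segment in the spatial coordinates and in u, lifted to the
hyperboloid. The lift only lowers the length, as y₀ enters the form negatively. The sign condition
puts both ends on the same sheet. -/
theorem inducedDist_le (hn : 1 ≤ n) {p q : Amb n × ℝ} (hp : p ∈ dom n 1) (hq : q ∈ dom n 1)
    (hpq : 0 < p.1 0 * q.1 0) {R : ℝ}
    (hR : ∀ t ∈ Icc (0 : ℝ) 1, r (p.2 + t * (q.2 - p.2)) ≤ R) :
    inducedDist n 1 (rotation n r θ) p q ≤ ENNReal.ofReal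
      √(R ^ 2 * ∑ j : Fin (n + 1), (q.1 j.succ - p.1 j.succ) ^ 2 + (q.2 - p.2) ^ 2) := by
  set Δ : Fin (n + 1) → ℝ := fun j => q.1 j.succ - p.1 j.succ with hΔ
  set z : ℝ → Fin (n + 1) → ℝ := fun t j => p.1 j.succ + t * Δ j with hz
  obtain ⟨σ, hσ, hσp, hσq⟩ : ∃ σ : ℝ, σ ^ 2 = 1 ∧ 0 < σ * p.1 0 ∧ 0 < σ * q.1 0 := by
    rcases pos_and_pos_or_neg_and_neg_of_mul_pos hpq with ⟨h1, h2⟩ | ⟨h1, h2⟩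
    · exact ⟨1, by norm_num, by linarith, by linarith⟩
    · exact ⟨-1, by norm_num, by linarith, by linarith⟩
  set γ : ℝ → Amb n × ℝ := fun t =>
    (Fin.cons (σ * √(1 + ∑ j, z t j ^ 2)) (z t), p.2 + t * (q.2 - p.2)) with hγ
  have hS : ∀ t, 0 < 1 + ∑ j, z t j ^ 2 := fun t =>
    add_pos_of_pos_of_nonneg one_pos (Finset.sum_nonneg fun j _ => sq_nonneg _)
  have hzc : ∀ j, ContDiff ℝ 1 fun t => z t j := fun j => by simp only [hz]; fun_prop
  have hγc : ContDiff ℝ 1 γ := by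
    refine ContDiff.prodMk (contDiff_pi.2 fun i => ?_) (by fun_prop)
    induction i using Fin.cases with
    | zero =>
      simp only [Fin.cons_zero]
      exact contDiff_const.mul ((contDiff_const.add
        (ContDiff.sum fun j _ => (hzc j).pow 2)).sqrt fun t => (hS t).ne')
    | succ j => simpa using hzc j
  have hdom : ∀ t, γ t ∈ dom n 1 := fun t => by
    obtain ⟨j₁, e1⟩ : ∃ j : Fin (n + 1), idx₁ n = j.succ :=
      ⟨⟨n - 1, by omega⟩, Fin.ext (by simp [idx₁]; omega)⟩
    obtain ⟨j₂, e2⟩ : ∃ j : Fin (n + 1), idx₂ n = j.succ := ⟨⟨n, by omega⟩, rfl⟩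
    refine ⟨⟨?_, ?_, ?_⟩, mem_univ _⟩
    · rw [form_one]
      simp only [hγ, Fin.cons_zero, Fin.cons_succ, ← sq]
      rw [mul_pow, hσ, Real.sq_sqrt (hS t).le]; ring
    · have h1 := hp.1.2.1
      have h2 := hq.1.2.1
      rw [e1] at h1 h2 ⊢
      simp [hγ, hz, hΔ, h1, h2]
    · have h1 := hp.1.2.2
      have h2 := hq.1.2.2
      rw [e2] at h1 h2 ⊢
      simp [hγ, hz, hΔ, h1, h2]
  have hend : ∀ (y : Amb n), form n 1 y y = -1 → 0 < σ * y 0 →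
      σ * √(1 + ∑ j : Fin (n + 1), y j.succ ^ 2) = y 0 := fun y hy h0 => by
    rw [form_one] at hy
    simp only [← sq] at hy
    have : 1 + ∑ j : Fin (n + 1), y j.succ ^ 2 = (σ * y 0) ^ 2 := by
      rw [mul_pow, hσ]; linarith
    rw [this, Real.sqrt_sq h0.le, ← mul_assoc, ← sq, hσ, one_mul]
  have hext : ∀ (y : Amb n) (a : ℝ), a = y 0 → (Fin.cons a fun j => y j.succ : Amb n) = y :=
    fun y a ha => by
      funext i
      exact Fin.cases (by simpa using ha) (fun j => by simp) i
  have h0 : γ 0 = p := by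
    refine Prod.ext ?_ (by simp [hγ])
    simp only [hγ, hz, zero_mul, add_zero]
    exact hext p.1 _ (hend p.1 hp.1.1 hσp)
  have h1 : γ 1 = q := by
    refine Prod.ext ?_ (by simp [hγ])
    simp only [hγ, hz, hΔ, one_mul, add_sub_cancel]
    exact hext q.1 _ (hend q.1 hq.1.1 hσq)
  refine (iInf₂_le γ ⟨hγc.contDiffOn, fun t _ => hdom t, h0, h1⟩).trans ?_
  have hbound : ∀ t ∈ Icc (0 : ℝ) 1, ENNReal.ofReal √(inducedMetric n 1 (rotation n r θ) (γ t)
      (derivWithin γ (Icc 0 1) t) (derivWithin γ (Icc 0 1) t)) ≤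
      ENNReal.ofReal √(R ^ 2 * ∑ j, Δ j ^ 2 + (q.2 - p.2) ^ 2) := fun t ht => by
    have hT := derivWithin_mem_tangent hγc.contDiffOn (fun t _ => hdom t) ht
    have hu := uniqueDiffOn_Icc (zero_lt_one (α := ℝ)) t ht
    have hd : HasDerivWithinAt γ (derivWithin γ (Icc 0 1) t) (Icc 0 1) t :=
      (hγc.contDiffOn.differentiableOn one_ne_zero t ht).hasDerivWithinAt
    rw [inducedMetric, H.form_fderiv_rotation hn (hdom t) hT hT]
    set X := derivWithin γ (Icc 0 1) t
    have hX2 : X.2 = q.2 - p.2 := by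
      refine hu.eq_deriv _ hd.snd ?_
      simpa [hγ] using (((hasDerivAt_id t).mul_const (q.2 - p.2)).const_add p.2).hasDerivWithinAt
    have hXj : ∀ j : Fin (n + 1), X.1 j.succ = Δ j := fun j => by
      refine hu.eq_deriv _ (hasDerivWithinAt_pi.1 hd.fst j.succ) ?_
      simpa [hγ, hz] using
        (((hasDerivAt_id t).mul_const (Δ j)).const_add (p.1 j.succ)).hasDerivWithinAt
    have hF : form n 1 X.1 X.1 ≤ ∑ j, Δ j ^ 2 := by
      rw [form_one]
      simp only [hXj, ← sq]
      nlinarith [sq_nonneg (X.1 0)]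
    refine ENNReal.ofReal_le_ofReal (Real.sqrt_le_sqrt ?_)
    have h2 : r (γ t).2 ^ 2 ≤ R ^ 2 := pow_le_pow_left₀ (H.pos _).le (hR t ht) 2
    have h3 : r (γ t).2 ^ 2 * form n 1 X.1 X.1 ≤ R ^ 2 * ∑ j, Δ j ^ 2 :=
      mul_le_mul h2 hF (form_nonneg (hdom t).1.1 hT.1) (sq_nonneg _)
    rw [hX2, ← sq]
    linarith
  refine (setLIntegral_mono' measurableSet_Icc hbound).trans ?_
  simp [hΔ]

/-- The Lipschitz functions make a Cauchy sequence converge in every coordinate, and the closed set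
`dom` contains the limit. `inducedDist_le` turns this into convergence for the induced distance. -/
theorem isCompleteMetric (hn : 1 ≤ n) {r₀ : ℝ} (hr₀ : 0 < r₀) (hle : ∀ u, r₀ ≤ r u) :
    IsCompleteMetric n 1 (rotation n r θ) := by
  intro x hx hcauchy
  have hconv : ∀ f : Amb n × ℝ → ℝ, (∀ p q, ‖f q - f p‖ₑ ≤
      inducedDist n 1 (rotation n r θ) p q) → ∃ l, Tendsto (fun j => f (x j)) atTop (𝓝 l) := by
    intro f hf
    refine cauchySeq_tendsto_of_complete (EMetric.cauchySeq_iff.2 fun ε hε => ?_)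
    obtain ⟨N, hN⟩ := hcauchy ε hε
    refine ⟨N, fun i hi j hj => ?_⟩
    rw [edist_eq_enorm_sub]
    exact (hf _ _).trans_lt (hN j hj i hi)
  obtain ⟨u, hu⟩ := hconv (fun p => p.2) fun p q => (H.enorm_sub_le_inducedDist hn hr₀ hle p q).1
  choose l hl using fun i => hconv (fun p => r₀ * Real.arsinh (p.1 i))
    fun p q => (H.enorm_sub_le_inducedDist hn hr₀ hle p q).2 i
  set y : Amb n := fun i => Real.sinh (l i / r₀) with hy
  have hyi : ∀ i, Tendsto (fun j => (x j).1 i) atTop (𝓝 (y i)) := fun i => by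
    have h1 := (Real.continuous_sinh.tendsto _).comp ((hl i).div_const r₀)
    refine h1.congr fun j => ?_
    simp [mul_div_cancel_left₀ _ hr₀.ne']
  have hlim : Tendsto x atTop (𝓝 (y, u)) := (tendsto_pi_nhds.2 hyi).prodMk_nhds hu
  have hmem : (y, u) ∈ dom n 1 := isClosed_dom.mem_of_tendsto hlim (Eventually.of_forall hx)
  refine ⟨(y, u), hmem, ?_⟩
  obtain ⟨R, hR⟩ := isCompact_Icc.bddAbove_image (K := Icc (u - 1) (u + 1))
    H.contDiff_r.continuous.continuousOn
  have hy0 : 0 < y 0 * y 0 := by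
    have := one_le_sq_zero hmem.1.1
    simp only at this
    nlinarith
  have hlimit : Tendsto (fun j => ENNReal.ofReal
      √(R ^ 2 * ∑ i : Fin (n + 1), (y i.succ - (x j).1 i.succ) ^ 2 + (u - (x j).2) ^ 2))
      atTop (𝓝 0) := by
    have h1 : Tendsto (fun j => R ^ 2 * ∑ i : Fin (n + 1), (y i.succ - (x j).1 i.succ) ^ 2 +
        (u - (x j).2) ^ 2) atTop
        (𝓝 (R ^ 2 * ∑ i : Fin (n + 1), (y i.succ - y i.succ) ^ 2 + (u - u) ^ 2)) :=
      ((tendsto_finsetSum _ fun i _ => ((hyi i.succ).const_sub _).pow 2).const_mul _).add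
        ((hu.const_sub u).pow 2)
    simpa using ENNReal.tendsto_ofReal h1.sqrt
  refine tendsto_of_tendsto_of_tendsto_of_le_of_le' tendsto_const_nhds hlimit
    (Eventually.of_forall fun _ => zero_le) ?_
  filter_upwards [((hyi 0).mul_const (y 0)).eventually_const_lt hy0,
    hu.eventually (Icc_mem_nhds (show u - 1 < u by linarith) (show u < u + 1 by linarith))]
    with j h1 h2
  refine H.inducedDist_le hn (hx j) hmem h1 fun t ht => hR (mem_image_of_mem _ ?_)
  have h3 := ht.1
  have h4 := ht.2
  constructor <;> simp only <;> nlinarith [h2.1, h2.2]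

end IsProfile

/-! ### From the solution g to a profile, and the total rotation angle -/

section Profile

variable {n : ℕ} {h c t₀ : ℝ} {g : ℝ → ℝ}

/-- A positive solution of the second-order equation gives the profile of a rotational
hypersurface of constant mean curvature. -/
theorem isProfile_of_solution (hc : c < 0) (hg : ContDiff ℝ ∞ g) (hpos : ∀ u, 0 < g u)
    (hode : ∀ u, deriv g u ^ 2 = q₁ n h c (g u))
    (hode₂ : ∀ u, HasDerivAt (deriv g) (g u * rate n h (g u ^ n)⁻¹) u) :
    IsProfile n h (rad c g) (fun u => deriv g u / √(-c)) (fun u => rad c g u * lam n h g u)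
      (fun u => n * h - (n - 1) * lam n h g u) (theta n h c g) := by
  have hs : 0 < √(-c) := Real.sqrt_pos.2 (by linarith)
  have hs2 : √(-c) ^ 2 = -c := Real.sq_sqrt (by linarith)
  have hne : ∀ u, g u ≠ 0 := fun u => (hpos u).ne'
  have hg' : ∀ u, HasDerivAt g (deriv g u) u := fun u =>
    (hg.differentiable (by simp) u).hasDerivAt
  have hr : ContDiff ℝ ∞ (rad c g) := hg.div_const _
  have hl : ContDiff ℝ ∞ (lam n h g) :=
    contDiff_const.add ((hg.pow n).inv fun u => pow_ne_zero n (hne u))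
  have hquot : ContDiff ℝ ∞ fun u => rad c g u * lam n h g u / (rad c g u ^ 2 + 1) :=
    (hr.mul hl).div ((hr.pow 2).add contDiff_const) fun u => by positivity
  have hθ : ∀ u, HasDerivAt (theta n h c g) (rad c g u * lam n h g u / (rad c g u ^ 2 + 1)) u :=
    fun u => intervalIntegral.integral_hasDerivAt_right (hquot.continuous.intervalIntegrable _ _)
      hquot.continuous.stronglyMeasurable.stronglyMeasurableAtFilter hquot.continuous.continuousAt
  refine
    { pos := fun u => div_pos (hpos u) hs
      contDiff_r := hr
      contDiff_r₁ := (contDiff_infty_iff_deriv.1 hg).2.div_const _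
      contDiff_m := hr.mul hl
      contDiff_θ := contDiff_infty_iff_deriv.2 ⟨fun u => (hθ u).differentiableAt, ?_⟩
      hasDerivAt_r := fun u => (hg' u).div_const _
      hasDerivAt_r₁ := fun u => ((hode₂ u).div_const _).congr_deriv ?_
      hasDerivAt_m := fun u => ?_
      hasDerivAt_θ := hθ
      energy := fun u => ?_
      mean := fun u => ?_ }
  · rwa [show deriv (theta n h c g) = _ from funext fun u => (hθ u).deriv]
  · simp only [rate, rad, lam]; ring
  · have h1 : HasDerivAt (lam n h g) (-(n * (g u ^ n)⁻¹ / g u) * deriv g u) u :=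
      ((hasDerivAt_inv_pow n (hne u)).comp u (hg' u)).const_add h
    refine (((hg' u).div_const (√(-c))).mul h1).congr_deriv ?_
    have := hne u
    simp only [lam]
    field_simp
    ring
  · rw [div_pow, hode, q₁, mul_pow, rad, div_pow, hs2, lam]
    have := hc.ne
    field_simp
    ring
  · have hr0 : rad c g u ≠ 0 := (div_pos (hpos u) hs).ne'
    rw [mul_div_cancel_left₀ _ hr0]; ring

/-- Comparison with `arctan (r' / h)` bounds the total rotation angle. -/
theorem theta_lt_theta (hh : 1 < h) (hc : c < 0) (hg : ContDiff ℝ ∞ g) (hpos : ∀ u, 0 < g u)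
    (hode : ∀ u, deriv g u ^ 2 = q₁ n h c (g u))
    (hode₂ : ∀ u, HasDerivAt (deriv g) (g u * rate n h (g u ^ n)⁻¹) u)
    (hsmall : ∀ u, (h + (g u ^ n)⁻¹) * ((h + (g u ^ n)⁻¹) ^ 2 - 1) ≤
      3 / 2 * h * rate n h (g u ^ n)⁻¹) (u v : ℝ) (huv : u < v) :
    theta n h c g u < theta n h c g v ∧ theta n h c g v < theta n h c g u + 2 * Real.pi := by
  have H := isProfile_of_solution hc hg hpos hode hode₂
  set r := rad c g with hr
  set θ := theta n h c g with hθ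
  set r₁ : ℝ → ℝ := fun u => deriv g u / √(-c) with hr₁
  have hw : ∀ u, 0 < (g u ^ n)⁻¹ := fun u => inv_pos.2 (pow_pos (hpos u) n)
  have hl : ∀ u, lam n h g u = h + (g u ^ n)⁻¹ := fun u => rfl
  have hl0 : ∀ u, h < lam n h g u := fun u => by rw [hl]; linarith [hw u]
  have hmono : StrictMono θ := strictMono_of_deriv_pos fun u => by
    rw [(H.hasDerivAt_θ u).deriv]
    have := H.pos u
    have := hl0 u
    have : 0 < lam n h g u := by linarith
    positivity
  have hF : ∀ u, HasDerivAt (fun u => 3 / 2 * Real.arctan (r₁ u / h))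
      (3 / 2 * (1 / (1 + (r₁ u / h) ^ 2) * (r u * rate n h (g u ^ n)⁻¹ / h))) u := fun u => by
    have h1 : HasDerivAt r₁ (r u * rate n h (g u ^ n)⁻¹) u :=
      (H.hasDerivAt_r₁ u).congr_deriv (by rw [rate, hl]; ring)
    exact ((h1.div_const h).arctan).const_mul _
  have hcmp : Monotone fun u => 3 / 2 * Real.arctan (r₁ u / h) - θ u := by
    refine monotone_of_hasDerivAt_nonneg (fun u => (hF u).sub (H.hasDerivAt_θ u)) fun u => ?_
    simp only [Pi.zero_apply, sub_nonneg]
    have hru := H.pos u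
    have hsm := hsmall u
    have hlu := hl0 u
    have hen := H.energy u
    rw [← hl] at hsm
    set l := lam n h g u
    set P := rate n h (g u ^ n)⁻¹
    change r₁ u ^ 2 = (r u * l) ^ 2 - r u ^ 2 - 1 at hen
    have e : 3 / 2 * (1 / (1 + (r₁ u / h) ^ 2) * (r u * P / h)) =
        r u * (3 / 2 * h * P) / (h ^ 2 + r₁ u ^ 2) := by
      have : h ≠ 0 := by linarith
      field_simp
    have hl1 : h ^ 2 < l ^ 2 := by nlinarith
    rw [e, div_le_div_iff₀ (by positivity) (by positivity), mul_assoc, mul_assoc]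
    refine mul_le_mul_of_nonneg_left ?_ (H.pos u).le
    -- By `energy`, h² + r₁² = (l² - 1)(r² + 1) - (l² - h²).
    calc l * (h ^ 2 + r₁ u ^ 2) ≤ l * ((l ^ 2 - 1) * (r u ^ 2 + 1)) :=
          mul_le_mul_of_nonneg_left (by rw [hen]; nlinarith) (by linarith)
      _ = l * (l ^ 2 - 1) * (r u ^ 2 + 1) := by ring
      _ ≤ 3 / 2 * h * P * (r u ^ 2 + 1) := mul_le_mul_of_nonneg_right hsm (by positivity)
  refine ⟨hmono huv, ?_⟩
  have h1 := hcmp huv.le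
  have h2 := Real.arctan_lt_pi_div_two (r₁ v / h)
  have h3 := Real.neg_pi_div_two_lt_arctan (r₁ u / h)
  simp only at h1
  linarith [Real.pi_pos]

/-- At w = 0 the two sides are h(h² - 1) and 3/2 of it, so the inequality is strict there and
persists for small w. A factor above 1 is needed here; the angle bound allows any factor up to 2. -/
theorem eventually_angle_bound (hn : 2 ≤ n) (hh : 1 < h) :
    ∀ᶠ t : ℝ in atTop, (h + (t ^ n)⁻¹) * ((h + (t ^ n)⁻¹) ^ 2 - 1) ≤
      3 / 2 * h * rate n h (t ^ n)⁻¹ := by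
  have h1 : Continuous fun w : ℝ => (h + w) * ((h + w) ^ 2 - 1) := by fun_prop
  have h2 : Continuous fun w : ℝ => 3 / 2 * h * rate n h w :=
    continuous_const.mul (continuous_rate n h)
  have h3 : (h + 0) * ((h + 0) ^ 2 - 1) < 3 / 2 * h * rate n h 0 := by
    have : 0 < h * (h ^ 2 - 1) := mul_pos (by linarith) (by nlinarith)
    simp only [rate]; nlinarith
  filter_upwards [(tendsto_inv_pow hn).eventually
    (h1.continuousAt.eventually_lt h2.continuousAt h3)] with t ht using ht.le

end Profile

end CMC

end

theorem mainTheorem3 (n : ℕ) (hn : 2 ≤ n) (h : ℝ) (hh : h < -1 ∨ 1 < h) :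
    ∃ c₁ : ℝ, ∀ c : ℝ, c < -CMC.c₀ n h →
      ∃ g : ℝ → ℝ, CMC.IsGlobalSolution n h c g ∧
        (c < 0 → ∀ k : ℕ, 1 ≤ k → k ≤ n →
          CMC.IsClosedImmersion n k (CMC.phi n h c g) ∧
          CMC.HasConstantMeanCurvature n k (CMC.phi n h c g) h ∧
          (k = 1 → CMC.IsSpacelike n k (CMC.phi n h c g) ∧
            CMC.IsCompleteMetric n k (CMC.phi n h c g)) ∧
          (1 < h → c < c₁ → CMC.IsEmbedded n k (CMC.phi n h c g))) := by
  have hh2 : 1 < h ^ 2 := by rcases hh with hh | hh <;> nlinarith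
  obtain ⟨t, ht, hrate, hqt⟩ := CMC.exists_critical hn hh
  obtain ⟨T, hT, hTt⟩ : ∃ T ≥ t, 1 < h → ∀ s ≥ T, (h + (s ^ n)⁻¹) * ((h + (s ^ n)⁻¹) ^ 2 - 1) ≤
      3 / 2 * h * CMC.rate n h (s ^ n)⁻¹ := by
    by_cases h1 : 1 < h
    · obtain ⟨T, hT⟩ := Filter.eventually_atTop.1 (CMC.eventually_angle_bound hn h1)
      exact ⟨max t T, le_max_left _ _, fun _ s hs => hT s ((le_max_right _ _).trans hs)⟩
    · exact ⟨t, le_rfl, fun h2 => (h1 h2).elim⟩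
  -- As q₁ is c plus a function of t, c < c₁ means exactly q₁(T) < 0. Then T can serve as the lower
  -- bound for g.
  refine ⟨-CMC.q₁ n h 0 T, fun c hc => ?_⟩
  obtain ⟨a, hta, hqa, haT⟩ : ∃ a ≥ t, CMC.q₁ n h c a < 0 ∧
      (c < -CMC.q₁ n h 0 T → T ≤ a) := by
    by_cases h1 : c < -CMC.q₁ n h 0 T
    · refine ⟨T, hT, ?_, fun _ => le_rfl⟩
      simp only [CMC.q₁] at h1 ⊢
      linarith
    · exact ⟨t, le_rfl, by rw [hqt]; linarith, fun h2 => (h1 h2).elim⟩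
  obtain ⟨g, hg, hag, hode₂, htend⟩ := CMC.exists_globalSolution_of_neg hn hh2 ht hrate hta hqa
  have ha : 0 < a := ht.trans_le hta
  have hpos : ∀ u, 0 < g u := fun u => ha.trans_le (hag u)
  refine ⟨g, hg, fun hc0 k hk1 hkn => ?_⟩
  have H := CMC.isProfile_of_solution hc0 hg.1 hpos hg.2.1 hode₂
  have hs : 0 < √(-c) := Real.sqrt_pos.2 (by linarith)
  have hr : Filter.Tendsto (CMC.rad c g) (Filter.cocompact ℝ) Filter.atTop :=
    htend.atTop_div_const hs
  refine ⟨H.isClosedImmersion hkn hr, H.hasConstantMeanCurvature hkn, ?_, fun h1 hc1 => ?_⟩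
  · rintro rfl
    exact ⟨H.isSpacelike hkn, H.isCompleteMetric hkn (div_pos ha hs)
      fun u => div_le_div_of_nonneg_right (hag u) hs.le⟩
  · exact H.isEmbedded hkn hr (CMC.theta_lt_theta h1 hc0 hg.1 hpos hg.2.1 hode₂
      fun u => hTt h1 _ ((haT hc1).trans (hag u)))
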